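/- Let $R$ be an associative ring with identity and with a pseudo-involution, i.e. an additive map $a\mapsto\overline a$ such that $\overline 1$ is invertible, $\overline{\overline a}=a$ and $\overline{ab}=\overline b\,\overline1^{-1}\,\overline a$ for all $a,b\in R$. Let $V$ be a right $R$-module with an anti-Hermitian form, i.e. a biadditive map $B:V\times V\to R$ with $B(ua,vb)=\overline a\,\overline1^{-1}B(u,v)b$ and $B(u,v)=-\overline{B(v,u)}$. Let $\mathfrak H$ be its Heisenberg group, i.e. the set $V\times R$ with the operation $(u,a)\dotplus(v,b)=(u+v,\,a+b+B(u,v))$, on which $R$ acts by $(u,a)\leftharpoonup b=(ub,\,\overline b\,\overline1^{-1}ab)$. Let $\mathfrak L$ be an odd form parameter, i.e. a subgroup of $\mathfrak H$ that is stable under this action of $R$ and satisfies $$\{(0,a+\overline a)\mid a\in R\}\ \le\ \mathfrak L\ \le\ \{(u,a)\mid a=\overline a+B(u,u)\}.$$ For an integer $n\ge3$ put $\Omega=\{1,\dots,n,-n,\dots,-1\}$, $\varepsilon_i=\overline1^{-1}$ for $i>0$ and $\varepsilon_i=-1$ for $i<0$. The odd unitary Steinberg group $\mathrm{StU}(2n,R,\mathfrak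 L)$ is the group with generators $X_{ij}(a)$ ($i,j\in\Omega$, $i\ne\pm j$, $a\in R$) and $X_i(\xi)$ ($i\in\Omega$, $\xi\in\mathfrak L$) and with the following relations, where $[x,y]=xyx^{-1}y^{-1}$, the elements $a,b$ of $R$ (in $X_{ij}(a)$, $X_{ij}(b)$) and $\xi,\zeta,(u,a),(v,b)$ of $\mathfrak L$ are arbitrary, and the indices are arbitrary subject to the stated conditions and to the condition that all generators that occur are defined: - $X_{ij}(a)=X_{-j,-i}(\varepsilon_{-j}\overline a\varepsilon_i)$; - $X_{ij}(a)X_{ij}(b)=X_{ij}(a+b)$; - $X_i(\xi)X_i(\zeta)=X_i(\xi\dotplus\zeta)$; - $[X_{ij}(a),X_{hk}(b)]=1$ for $h\notin\{j,-i\}$, $k\notin\{i,-j\}$; - $[X_i(\xi),X_{jk}(a)]=1$ for $j\ne-i$, $k\ne i$; - $[X_{ij}(a),X_{jk}(b)]=X_{ik}(ab)$; - $[X_i(u,a),X_j(v,b)]=X_{i,-j}(\varepsilon_iB(u,v))$ for $i\ne\pm j$; - $[X_i(u,a),X_i(v,b)]=X_i(0,\,B(u,v)-B(v,u))$; - $[X_i(u,a),X_{-i,j}(b)]=X_{ij}(\varepsilon_iab)\,X_{-j}((u,-\overline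 a)\leftharpoonup b)$; - $[X_{ij}(a),X_{j,-i}(b)]=X_i(0,\,-\varepsilon_{-i}\overline1ab+\overline b\,\overline1^{-1}\overline a\varepsilon_i)$. Let $\mathrm{StU}(\infty,R,\mathfrak L)$ be the direct limit of the groups $\mathrm{StU}(2n,R,\mathfrak L)$, $n\ge3$, along the homomorphisms that send each generator to the generator with the same name. A central extension of a group $G$ is a surjective homomorphism $H\to G$ whose kernel lies in the center of $H$; a central extension $\pi:U\to G$ is universal if for every central extension $\epsilon:H\to G$ there is exactly one homomorphism $\eta:U\to H$ with $\epsilon\eta=\pi$. The Schur multiplier $\mathrm M(G)$ of a perfect group $G$ is the kernel of a universal central extension of $G$ (well defined up to isomorphism), and a perfect group $G$ is centrally closed if the identity map of $G$ is a universal central extension of $G$. **Theorem.** For every integer $n\ge5$ and for $n=\infty$, the group $\mathrm{StU}(2n,R,\mathfrak L)$ (for $n=\infty$, the group $\mathrm{StU}(\infty,R,\mathfrak L)$) is perfect and centrally closed, and its Schur multiplier is trivial: every universal central extension of it has trivial kernel. -/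

import Mathlib

universe u v w

/-! ### Central extensions -/

/-- A homomorphism of groups is a central extension (of its codomain) if it is surjective and
its kernel is contained in the center of its domain. -/
structure IsCentralExtension {H : Type u} {G : Type v} [Group H] [Group G] (ε : H →* G) :
    Prop where
  surjective : Function.Surjective ε
  ker_le_center : ε.ker ≤ Subgroup.center H

/-- A central extension `π : U → G` is universal if for any central extension `ε : H → G` there is
a unique homomorphism `η : U → H` over `G`. The groups `H` range over the universe `w`. -/
structure IsUniversalCentralExtension {U : Type u} {G : Type v} [Group U] [Group G]
    (π : U →* G) : Prop where
  isCentralExtension : IsCentralExtension π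
  existsUnique_lift : ∀ (H : Type w) [Group H] (ε : H →* G), IsCentralExtension ε →
    ∃! η : U →* H, ε.comp η = π

/-- A perfect group `G` is centrally closed if the identity of `G` is a universal central
extension of `G`. -/
structure IsCentrallyClosed (G : Type v) [Group G] : Prop where
  isPerfect : Group.IsPerfect G
  isUniversal : IsUniversalCentralExtension.{v, v, w} (MonoidHom.id G)

/-! ### Pseudo-involutions, anti-Hermitian forms and odd form parameters -/

/-- A pseudo-involution on an associative ring with identity. -/
structure PseudoInvolution (R : Type u) [Ring R] where
  bar : R →+ R
  isUnit_bar_one : IsUnit (bar 1)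
  bar_bar : ∀ a, bar (bar a) = a
  bar_mul : ∀ a b, bar (a * b) = bar b * Ring.inverse (bar 1) * bar a

namespace PseudoInvolution

variable {R : Type u} [Ring R] (P : PseudoInvolution R)

/-- The element `1̄⁻¹` of `R`. -/
noncomputable def oneInv : R := Ring.inverse (P.bar 1)

theorem bar_one_mul_oneInv : P.bar 1 * P.oneInv = 1 :=
  Ring.mul_inverse_cancel _ P.isUnit_bar_one

theorem oneInv_mul_bar_one : P.oneInv * P.bar 1 = 1 :=
  Ring.inverse_mul_cancel _ P.isUnit_bar_one

theorem bar_mul' (a b : R) : P.bar (a * b) = P.bar b * P.oneInv * P.bar a := P.bar_mul a b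

end PseudoInvolution

/-- An anti-Hermitian form on the right `R`-module `V`; here `MulOpposite.op a • u` is `ua`. -/
structure AntiHermitianForm {R : Type u} [Ring R] (P : PseudoInvolution R)
    (V : Type v) [AddCommGroup V] [Module Rᵐᵒᵖ V] where
  form : V →+ V →+ R
  form_smul_smul : ∀ (x y : V) (a b : R),
    form (MulOpposite.op a • x) (MulOpposite.op b • y) = P.bar a * P.oneInv * form x y * b
  form_swap : ∀ x y : V, form x y = -P.bar (form y x)

/-- The underlying set `V × R` of the Heisenberg group of an anti-Hermitian form. -/
@[ext]
structure Heisenberg {R : Type u} [Ring R] {P : PseudoInvolution R}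
    {V : Type v} [AddCommGroup V] [Module Rᵐᵒᵖ V] (B : AntiHermitianForm P V) where
  vec : V
  scal : R

namespace Heisenberg

variable {R : Type u} [Ring R] {P : PseudoInvolution R}
  {V : Type v} [AddCommGroup V] [Module Rᵐᵒᵖ V] {B : AntiHermitianForm P V}

instance : Zero (Heisenberg B) := ⟨⟨0, 0⟩⟩

instance : Add (Heisenberg B) :=
  ⟨fun ξ ζ => ⟨ξ.vec + ζ.vec, ξ.scal + ζ.scal + B.form ξ.vec ζ.vec⟩⟩

instance : Neg (Heisenberg B) := ⟨fun ξ => ⟨-ξ.vec, -ξ.scal + B.form ξ.vec ξ.vec⟩⟩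

@[simp] theorem vec_zero : (0 : Heisenberg B).vec = 0 := rfl
@[simp] theorem scal_zero : (0 : Heisenberg B).scal = 0 := rfl
@[simp] theorem vec_add (ξ ζ : Heisenberg B) : (ξ + ζ).vec = ξ.vec + ζ.vec := rfl
@[simp] theorem scal_add (ξ ζ : Heisenberg B) :
    (ξ + ζ).scal = ξ.scal + ζ.scal + B.form ξ.vec ζ.vec := rfl
@[simp] theorem vec_neg (ξ : Heisenberg B) : (-ξ).vec = -ξ.vec := rfl
@[simp] theorem scal_neg (ξ : Heisenberg B) :
    (-ξ).scal = -ξ.scal + B.form ξ.vec ξ.vec := rfl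

/-- The Heisenberg group, written additively although it need not be commutative:
`(u, a) + (v, b) = (u + v, a + b + B(u, v))`. -/
instance : AddGroup (Heisenberg B) :=
  AddGroup.ofLeftAxioms
    (fun ξ ζ η => by ext <;> simp <;> abel)
    (fun ξ => by ext <;> simp)
    (fun ξ => by ext <;> simp)

/-- The right action of `R` on the Heisenberg group: `(u, a) ↼ b = (ub, b̄ 1̄⁻¹ a b)`. -/
noncomputable def act (ξ : Heisenberg B) (b : R) : Heisenberg B :=
  ⟨MulOpposite.op b • ξ.vec, P.bar b * P.oneInv * ξ.scal * b⟩

variable (B)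

/-- The minimal odd form parameter. -/
def Lmin : AddSubgroup (Heisenberg B) where
  carrier := {ξ | ∃ a : R, ξ = ⟨0, a + P.bar a⟩}
  zero_mem' := ⟨0, by ext <;> simp⟩
  add_mem' := by
    rintro _ _ ⟨a, rfl⟩ ⟨b, rfl⟩
    exact ⟨a + b, by ext <;> simp <;> abel⟩
  neg_mem' := by
    rintro _ ⟨a, rfl⟩
    exact ⟨-a, by ext <;> simp <;> abel⟩

/-- The maximal odd form parameter. -/
def Lmax : AddSubgroup (Heisenberg B) where
  carrier := {ξ | ξ.scal = P.bar ξ.scal + B.form ξ.vec ξ.vec}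
  zero_mem' := by simp
  add_mem' := by
    intro ξ ζ hξ hζ
    have h1 : P.bar (B.form ξ.vec ζ.vec) = -B.form ζ.vec ξ.vec := by
      rw [B.form_swap ζ.vec ξ.vec, neg_neg]
    simp only [Set.mem_ofPred_eq, scal_add, vec_add, map_add, AddMonoidHom.add_apply, h1] at *
    nth_rewrite 1 [hξ, hζ]
    abel
  neg_mem' := by
    intro ξ hξ
    have h1 : P.bar (B.form ξ.vec ξ.vec) = -B.form ξ.vec ξ.vec := by
      conv_rhs => rw [B.form_swap ξ.vec ξ.vec, neg_neg]
    simp only [Set.mem_ofPred_eq, scal_neg, vec_neg, map_add, map_neg,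
      AddMonoidHom.neg_apply, h1, neg_neg] at *
    nth_rewrite 1 [hξ]
    abel

end Heisenberg

/-- An odd form parameter of the form `B`: a subgroup of the Heisenberg group between the minimal
and the maximal one which is stable under the action of `R`. -/
structure OddFormParameter {R : Type u} [Ring R] {P : PseudoInvolution R}
    {V : Type v} [AddCommGroup V] [Module Rᵐᵒᵖ V] (B : AntiHermitianForm P V) where
  toAddSubgroup : AddSubgroup (Heisenberg B)
  min_le : Heisenberg.Lmin B ≤ toAddSubgroup
  le_max : toAddSubgroup ≤ Heisenberg.Lmax B
  act_mem : ∀ ξ ∈ toAddSubgroup, ∀ b : R, ξ.act b ∈ toAddSubgroup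

/-! ### Indices -/

/-- The index set `Ω = {1, …, n, -n, …, -1}`. -/
abbrev Omega (n : ℕ) : Type := {i : ℤ // i ≠ 0 ∧ |i| ≤ n}

namespace Omega

variable {n m : ℕ}

instance : Neg (Omega n) := ⟨fun i => ⟨-i.1, by simpa using i.2⟩⟩

@[simp] theorem coe_neg (i : Omega n) : ((-i : Omega n) : ℤ) = -(i : ℤ) := rfl

/-- `i ∉ {±j}`. -/
def Apart (i j : Omega n) : Prop := i ≠ j ∧ i ≠ -j

theorem apart_iff {i j : Omega n} : Apart i j ↔ (i : ℤ) ≠ j ∧ (i : ℤ) ≠ -j := by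
  simp [Apart, ← Subtype.coe_inj]

theorem Apart.neg_swap {i j : Omega n} (h : Apart i j) : Apart (-j) (-i) := by
  rw [apart_iff] at *; simp only [coe_neg]; omega

theorem Apart.neg_left {i j : Omega n} (h : Apart i j) : Apart (-i) j := by
  rw [apart_iff] at *; simp only [coe_neg]; omega

theorem Apart.neg_right {i j : Omega n} (h : Apart i j) : Apart i (-j) := by
  rw [apart_iff] at *; simp only [coe_neg]; omega

theorem Apart.symm {i j : Omega n} (h : Apart i j) : Apart j i := by
  rw [apart_iff] at *; omega

/-- `ε_i = 1̄⁻¹` for `i > 0` and `ε_i = -1` for `i < 0`. -/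
noncomputable def eps {R : Type u} [Ring R] (P : PseudoInvolution R) (i : Omega n) : R :=
  if 0 < (i : ℤ) then P.oneInv else -1

/-- The inclusion of index sets for `n ≤ m`. -/
def incl (h : n ≤ m) (i : Omega n) : Omega m :=
  ⟨i.1, i.2.1, i.2.2.trans (by exact_mod_cast h)⟩

@[simp] theorem coe_incl (h : n ≤ m) (i : Omega n) : (incl h i : ℤ) = i := rfl

theorem incl_neg (h : n ≤ m) (i : Omega n) : incl h (-i) = -incl h i := rfl

theorem incl_injective (h : n ≤ m) : Function.Injective (incl h) := fun i j hij =>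
  Subtype.ext (by simpa using congrArg (fun k : Omega m => (k : ℤ)) hij)

theorem Apart.incl {i j : Omega n} (hij : Apart i j) (h : n ≤ m) :
    Apart (incl h i) (incl h j) := by
  rw [apart_iff] at *; simpa using hij

end Omega

/-! ### The odd unitary Steinberg group -/

namespace OddFormParameter

open Omega
open scoped commutatorElement

variable {R : Type u} [Ring R] {P : PseudoInvolution R}
  {V : Type v} [AddCommGroup V] [Module Rᵐᵒᵖ V] {B : AntiHermitianForm P V}
  (L : OddFormParameter B)

/-- The elements of the odd form parameter. -/
abbrev Elt : Type (max u v) := L.toAddSubgroup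

variable {L}

/-- `(u, a) ↼ b` as an element of the odd form parameter. -/
noncomputable def Elt.act (ξ : L.Elt) (b : R) : L.Elt := ⟨ξ.1.act b, L.act_mem _ ξ.2 b⟩

/-- `(u, a) ↦ (u, -ā)` as a map of the odd form parameter to itself. -/
def Elt.conj (ξ : L.Elt) : L.Elt :=
  ⟨⟨ξ.1.vec, -P.bar ξ.1.scal⟩, by
    have hmax : ξ.1.scal = P.bar ξ.1.scal + B.form ξ.1.vec ξ.1.vec := L.le_max ξ.2
    have h1 : P.bar (-1) * P.oneInv = -1 := by
      rw [map_neg, neg_mul, P.bar_one_mul_oneInv]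
    have h2 := neg_mem (L.act_mem _ ξ.2 (-1))
    convert h2 using 1
    ext
    · simp [Heisenberg.act]
    · simp only [Heisenberg.act, Heisenberg.scal_neg, h1]
      simp only [MulOpposite.op_neg, MulOpposite.op_one, neg_smul, one_smul, map_neg,
        AddMonoidHom.neg_apply, neg_neg, neg_mul, one_mul, mul_neg, mul_one]
      nth_rewrite 2 [hmax]
      abel⟩

variable (L)

/-- The element `(0, c + c̄)` of the odd form parameter. -/
def trace (c : R) : L.Elt := ⟨⟨0, c + P.bar c⟩, L.min_le ⟨c, rfl⟩⟩

/-- The element `(0, B(u, v) - B(v, u))` for `ξ = (u, a)` and `ζ = (v, b)`. -/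
def bracket (ξ ζ : L.Elt) : L.Elt :=
  ⟨⟨0, B.form ξ.1.vec ζ.1.vec - B.form ζ.1.vec ξ.1.vec⟩, by
    rw [B.form_swap ζ.1.vec ξ.1.vec, sub_neg_eq_add]
    exact L.min_le ⟨_, rfl⟩⟩

/-- The element `(0, -ε_{-i} 1̄ a b + b̄ 1̄⁻¹ ā ε_i)`. -/
noncomputable def hyp {n : ℕ} (i : Omega n) (a b : R) : L.Elt :=
  ⟨⟨0, -(eps P (-i) * P.bar 1 * a * b) + P.bar b * P.oneInv * P.bar a * eps P i⟩, by
    have h : P.bar b * P.oneInv * P.bar a * eps P i =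
        P.bar (-(eps P (-i) * P.bar 1 * a * b)) := by
      rcases lt_or_gt_of_ne i.2.1 with hi | hi
      · have h1 : eps P i = -1 := if_neg (by omega)
        have h2 : eps P (-i) = P.oneInv := if_pos (by simpa using hi)
        rw [h1, h2, P.oneInv_mul_bar_one, one_mul, map_neg, P.bar_mul' a b, mul_neg, mul_one]
      · have h1 : eps P i = P.oneInv := if_pos hi
        have h2 : eps P (-i) = -1 := if_neg (by simp only [coe_neg]; omega)
        rw [h1, h2, neg_mul, neg_mul, neg_mul, neg_neg, one_mul, mul_assoc (P.bar 1),
          P.bar_mul' _ (a * b), P.bar_bar, mul_one, P.bar_mul']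
    rw [h]
    exact L.min_le ⟨_, rfl⟩⟩

/-- The generators `X_{ij}(a)`, `i ∉ {±j}`, `a ∈ R`, and `X_i(ξ)`, `ξ ∈ 𝔏`. -/
inductive Gen (n : ℕ) : Type (max u v)
  | short (i j : Omega n) (h : Apart i j) (a : R) : Gen n
  | long (i : Omega n) (ξ : L.Elt) : Gen n

/-- The generator `X_{ij}(a)` in the free group. -/
def X {n : ℕ} (i j : Omega n) (h : Apart i j) (a : R) : FreeGroup (L.Gen n) :=
  FreeGroup.of (Gen.short i j h a)

/-- The generator `X_i(ξ)` in the free group. -/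
def Y {n : ℕ} (i : Omega n) (ξ : L.Elt) : FreeGroup (L.Gen n) :=
  FreeGroup.of (Gen.long i ξ)

/-- The defining relations of the odd unitary Steinberg group;
`⁅x, y⁆ = x * y * x⁻¹ * y⁻¹`. -/
inductive Rel (n : ℕ) : FreeGroup (L.Gen n) → FreeGroup (L.Gen n) → Prop
  | r0 (i j : Omega n) (h : Apart i j) (a : R) :
      Rel n (L.X i j h a) (L.X (-j) (-i) h.neg_swap (eps P (-j) * P.bar a * eps P i))
  | r1 (i j : Omega n) (h : Apart i j) (a b : R) :
      Rel n (L.X i j h a * L.X i j h b) (L.X i j h (a + b))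
  | r2 (i : Omega n) (ξ ζ : L.Elt) :
      Rel n (L.Y i ξ * L.Y i ζ) (L.Y i (ξ + ζ))
  | r3 (i j h k : Omega n) (hij : Apart i j) (hhk : Apart h k) (a b : R) :
      h ≠ j → h ≠ -i → k ≠ i → k ≠ -j →
      Rel n ⁅L.X i j hij a, L.X h k hhk b⁆ 1
  | r4 (i j k : Omega n) (hjk : Apart j k) (ξ : L.Elt) (a : R) :
      j ≠ -i → k ≠ i →
      Rel n ⁅L.Y i ξ, L.X j k hjk a⁆ 1
  | r5 (i j k : Omega n) (hij : Apart i j) (hjk : Apart j k) (hik : Apart i k) (a b : R) :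
      Rel n ⁅L.X i j hij a, L.X j k hjk b⁆ (L.X i k hik (a * b))
  | r6 (i j : Omega n) (hij : Apart i j) (ξ ζ : L.Elt) :
      Rel n ⁅L.Y i ξ, L.Y j ζ⁆ (L.X i (-j) hij.neg_right (eps P i * B.form ξ.1.vec ζ.1.vec))
  | r7 (i : Omega n) (ξ ζ : L.Elt) :
      Rel n ⁅L.Y i ξ, L.Y i ζ⁆ (L.Y i (L.bracket ξ ζ))
  | r8 (i j : Omega n) (hij : Apart i j) (ξ : L.Elt) (b : R) :
      Rel n ⁅L.Y i ξ, L.X (-i) j hij.neg_left b⁆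
        (L.X i j hij (eps P i * ξ.1.scal * b) * L.Y (-j) (ξ.conj.act b))
  | r9 (i j : Omega n) (hij : Apart i j) (a b : R) :
      Rel n ⁅L.X i j hij a, L.X j (-i) hij.symm.neg_right b⁆ (L.Y i (L.hyp i a b))

/-- The odd unitary Steinberg group `StU(2n, R, 𝔏)`. -/
def StU (n : ℕ) : Type (max u v) :=
  PresentedGroup {r : FreeGroup (L.Gen n) | ∃ x y, L.Rel n x y ∧ r = x * y⁻¹}

instance (n : ℕ) : Group (L.StU n) :=
  inferInstanceAs (Group (PresentedGroup
    {r : FreeGroup (L.Gen n) | ∃ x y, L.Rel n x y ∧ r = x * y⁻¹}))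

/-! ### The stable odd unitary Steinberg group -/

variable {L} {n m : ℕ}

/-- The map on generators for `n ≤ m`. -/
def Gen.incl (h : n ≤ m) : L.Gen n → L.Gen m
  | .short i j hij a => .short (Omega.incl h i) (Omega.incl h j) (hij.incl h) a
  | .long i ξ => .long (Omega.incl h i) ξ

theorem map_X (h : n ≤ m) (i j : Omega n) (hij : Apart i j) (a : R) :
    FreeGroup.map (Gen.incl h) (L.X i j hij a) =
      L.X (incl h i) (incl h j) (hij.incl h) a := FreeGroup.map.of

theorem map_Y (h : n ≤ m) (i : Omega n) (ξ : L.Elt) :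
    FreeGroup.map (Gen.incl h) (L.Y i ξ) = L.Y (incl h i) ξ := FreeGroup.map.of

theorem Rel.map (h : n ≤ m) {x y : FreeGroup (L.Gen n)} (hxy : L.Rel n x y) :
    L.Rel m (FreeGroup.map (Gen.incl h) x) (FreeGroup.map (Gen.incl h) y) := by
  have hinj := incl_injective h
  cases hxy with
  | r0 i j hij a => simp only [map_X]; exact .r0 _ _ (hij.incl h) a
  | r1 i j hij a b => simp only [map_mul, map_X]; exact .r1 _ _ _ a b
  | r2 i ξ ζ => simp only [map_mul, map_Y]; exact .r2 _ ξ ζ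
  | r3 i j k l hij hkl a b h1 h2 h3 h4 =>
    simp only [map_commutatorElement, map_X, map_one]
    exact .r3 _ _ _ _ _ _ a b (hinj.ne h1) (fun e => h2 (hinj e)) (hinj.ne h3)
      (fun e => h4 (hinj e))
  | r4 i j k hjk ξ a h1 h2 =>
    simp only [map_commutatorElement, map_X, map_Y, map_one]
    exact .r4 _ _ _ _ ξ a (fun e => h1 (hinj e)) (hinj.ne h2)
  | r5 i j k hij hjk hik a b =>
    simp only [map_commutatorElement, map_X]; exact .r5 _ _ _ _ _ _ a b
  | r6 i j hij ξ ζ =>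
    simp only [map_commutatorElement, map_X, map_Y]; exact .r6 _ _ (hij.incl h) ξ ζ
  | r7 i ξ ζ => simp only [map_commutatorElement, map_Y]; exact .r7 _ ξ ζ
  | r8 i j hij ξ b =>
    simp only [map_commutatorElement, map_mul, map_X, map_Y]; exact .r8 _ _ (hij.incl h) ξ b
  | r9 i j hij a b =>
    simp only [map_commutatorElement, map_X, map_Y]; exact .r9 _ _ (hij.incl h) a b

variable (L)

/-- The natural homomorphism `StU(2n, R, 𝔏) → StU(2m, R, 𝔏)` for `n ≤ m`, which sends generators
to generators with the same names. -/
def stuMap (h : n ≤ m) : L.StU n →* L.StU m :=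
  PresentedGroup.map (FreeGroup.map (Gen.incl h)) (by
    rintro _ ⟨x, y, hxy, rfl⟩
    exact ⟨_, _, hxy.map h, by simp⟩)

theorem stuMap_mk (h : n ≤ m) (x : FreeGroup (L.Gen n)) :
    L.stuMap h (PresentedGroup.mk _ x) =
      PresentedGroup.mk _ (FreeGroup.map (Gen.incl h) x) := rfl

instance : DirectedSystem (fun k : Set.Ici (3 : ℕ) => L.StU k)
    (fun k l (h : k ≤ l) => L.stuMap (Subtype.coe_le_coe.mpr h)) where
  map_self k x := by
    obtain ⟨x, rfl⟩ := PresentedGroup.mk_surjective _ x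
    rw [stuMap_mk]
    have : (Gen.incl (L := L) (le_refl (k : ℕ))) = id := by
      funext g; cases g <;> rfl
    exact congrArg _ ((congrArg (fun f => FreeGroup.map f x) this).trans (FreeGroup.map.id x))
  map_map j k l hij hjk x := by
    obtain ⟨x, rfl⟩ := PresentedGroup.mk_surjective _ x
    simp only [stuMap_mk, FreeGroup.map.comp]
    congr 2
    congr 1
    funext g; cases g <;> rfl

/-- The group `StU(∞, R, 𝔏)`, the direct limit of the groups `StU(2n, R, 𝔏)`, `n ≥ 3`. -/
abbrev StUInf : Type (max u v) :=
  DirectLimit (fun k : Set.Ici (3 : ℕ) => L.StU k)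
    (fun k l (h : k ≤ l) => L.stuMap (Subtype.coe_le_coe.mpr h))

end OddFormParameter

/-! It suffices to split every central extension `ε : H → G` of the Steinberg group: for a perfect
group a section is automatically unique, so the identity is then universal. To build a section, the
generators are lifted to `H` so that all defining relations still hold.

The lifts are canonical because a commutator in `H` depends only on the images of its two entries
(`IsCentralExtension.commutatorElement_congr`). Hence elements of `H` over commuting generators
commute as soon as one of them lies over a commutator of elements that commute with the image of the
other. A generator `x h k b` is such a commutator through any spare index `m`, and `n ≥ 5`
guarantees an index avoiding four given ones up to sign (`exists_apart`).

The lift of `x i j a` is a commutator of lifts of `x i k a` and `x k j 1`; a Hall–Witt argument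
shows that neither `k` nor the way `a` is split as a product matters (`lift_short_short_shift`,
`commutatorElement_eq_liftShort`). The same formula with `j = -i` is kept on purpose: it lifts the
long generators with parameter `L.hypElt i a`. The remaining long generators are lifted by what is
left of `[y i ξ, x (-i) j b]` after its short factor is removed. This remainder depends only on the
long generator below it, by `preLiftLong_eq_mul`. The two lifts of `y i (L.hypElt i a)` agree by
`liftLong_hypElt`, and additivity of the long lifts is `liftLong_add`; `SteinbergRel.lift` collects
the relations.

For `n = ∞` the lifts at the finite levels are unique by perfectness, hence compatible, and glue to
a section on the direct limit. Triviality of the multiplier is formal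
(`IsCentrallyClosed.ker_eq_bot`). -/

open scoped commutatorElement

/-! ### Identities with commutators -/

section CommutatorIdentities

variable {G : Type*} [Group G]

theorem Commute.conj_eq {a b : G} (h : Commute a b) : a * b * a⁻¹ = b := by
  rw [h.eq, mul_inv_cancel_right]

theorem commutatorElement_mul_left_of_commute {a b c : G} (h : Commute a ⁅b, c⁆) :
    ⁅a * b, c⁆ = ⁅b, c⁆ * ⁅a, c⁆ := by
  rw [show ⁅a * b, c⁆ = a * ⁅b, c⁆ * a⁻¹ * ⁅a, c⁆ by simp [commutatorElement_def, mul_assoc],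
    h.conj_eq]

theorem commutatorElement_mul_right_of_commute {a b c : G} (h : Commute b ⁅a, c⁆) :
    ⁅a, b * c⁆ = ⁅a, b⁆ * ⁅a, c⁆ := by
  rw [show ⁅a, b * c⁆ = ⁅a, b⁆ * (b * ⁅a, c⁆ * b⁻¹) by simp [commutatorElement_def, mul_assoc],
    h.conj_eq]

/-- A form of the Hall–Witt identity. -/
theorem commutatorElement_assoc {a b c : G} (hac : Commute a c) (h₁ : Commute ⁅b, c⁆ ⁅a, b⁆)
    (h₂ : Commute ⁅b, c⁆ ⁅a, ⁅b, c⁆⁆) : ⁅⁅a, b⁆, c⁆ = ⁅a, ⁅b, c⁆⁆ := by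
  have e₁ : c * ⁅a, b⁆ * c⁻¹ = ⁅a, ⁅b, c⁆⁻¹ * b⁆ := by
    rw [conjugate_commutatorElement, hac.symm.conj_eq]
    congr 1
    simp [commutatorElement_def, mul_assoc]
  have e₂ : ⁅a, ⁅b, c⁆⁻¹ * b⁆ = ⁅a, ⁅b, c⁆⁻¹⁆ * ⁅a, b⁆ :=
    commutatorElement_mul_right_of_commute h₁.inv_left
  have e₃ : ⁅a, ⁅b, c⁆⁻¹⁆ = ⁅a, ⁅b, c⁆⁆⁻¹ := by
    rw [commutatorElement_inv_right, ← commutatorElement_inv a ⁅b, c⁆]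
    have := h₂.inv_left.inv_right.conj_eq
    rwa [inv_inv] at this
  calc ⁅⁅a, b⁆, c⁆ = ⁅a, b⁆ * (c * ⁅a, b⁆ * c⁻¹)⁻¹ := by
        simp only [commutatorElement_def, mul_inv_rev, inv_inv, mul_assoc]
    _ = ⁅a, ⁅b, c⁆⁆ := by
        rw [e₁, e₂, e₃, mul_inv_rev, inv_inv, mul_inv_cancel_left]

theorem commutatorElement_commutatorElement_right {a b c : G} (hac : Commute a c) :
    a * ⁅b, c⁆ * a⁻¹ = ⁅⁅a, b⁆ * b, c⁆ := by
  rw [conjugate_commutatorElement, hac.conj_eq]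
  congr 1
  simp [commutatorElement_def, mul_assoc]

/-- Conjugating `[b, c] = t s` by `a` gives `t [a, s] s` on one side. On the other it gives `[[a, b]
b, c] = t s r`, and `t` and `s` cancel. It serves to compute commutators with an element `s` known
only as a factor of a commutator. -/
theorem commutatorElement_eq_of_commutatorElement_eq_mul {a b c s t r : G} (hac : Commute a c)
    (hs : ⁅b, c⁆ = t * s) (hat : Commute a t) (hr : ⁅⁅a, b⁆, c⁆ = r)
    (hdt : Commute ⁅a, b⁆ t) (hds : Commute ⁅a, b⁆ s) (hrs : Commute r s) : ⁅a, s⁆ = r := by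
  have e := commutatorElement_commutatorElement_right (b := b) hac
  rw [commutatorElement_mul_left_eq_conj_mul, hs, hr, (hdt.mul_right hds).conj_eq] at e
  have e' : a * (t * s) * a⁻¹ = t * (⁅a, s⁆ * s) := by
    rw [show a * (t * s) * a⁻¹ = a * t * a⁻¹ * (a * s * a⁻¹) by group, hat.conj_eq,
      commutatorElement_def, inv_mul_cancel_right]
  rw [e', mul_assoc, mul_right_inj, ← hrs.eq, mul_left_inj] at e
  exact e

/-- Expanding `a m a⁻¹ = [p q b, c]`, the contributions of `n` cancel and `s m t` remains. The
hypotheses are modelled on `preLiftLong_eq_mul`, where `a` and `q` are long, `p`, `b`, `c`, `m`, `t`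
are short and `s` is the long factor of `[q, c]`. -/
theorem inv_mul_commutatorElement_commutatorElement {a b c p q m n s t : G} (hac : Commute a c)
    (hm : ⁅b, c⁆ = m) (hpq : ⁅a, b⁆ = p * q) (hqm : Commute q m) (hpm : ⁅p, m⁆ = n)
    (hqc : ⁅q, c⁆ = n⁻¹ * s) (hpc : ⁅p, c⁆ = t) (hpn : Commute p n) (hps : Commute p s)
    (hnm : Commute n m) (hms : Commute m s) (hts : Commute t s) (htm : Commute t ⁅m, t⁆) :
    t⁻¹ * ⁅a, m⁆ = s * ⁅m, t⁆ := by
  have e := commutatorElement_commutatorElement_right (b := b) hac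
  have e₁ : p * q * m * (p * q)⁻¹ = n * m := by
    rw [← hpm, commutatorElement_def, inv_mul_cancel_right, mul_inv_rev,
      show p * q * m * (q⁻¹ * p⁻¹) = p * (q * m * q⁻¹) * p⁻¹ by group, hqm.conj_eq]
  have e₂ : ⁅p * q, c⁆ = n⁻¹ * s * t := by
    rw [commutatorElement_mul_left_eq_conj_mul, hqc, hpc, (hpn.inv_right.mul_right hps).conj_eq]
  rw [hm, hpq, commutatorElement_mul_left_eq_conj_mul, hm, e₁, e₂] at e
  have e₃ : a * m * a⁻¹ = s * m * t := by
    rw [e, hnm.eq, ← hms.eq]; group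
  have e₄ : ⁅a, m⁆ = s * ⁅m, t⁆ * t := by
    rw [commutatorElement_def a m, e₃, commutatorElement_def]; group
  rw [e₄, (hts.mul_right htm).symm.eq, inv_mul_cancel_left]

/-- Conjugation by `c` turns `h = [a, b]` into `[p a, q b]`, which the commutation hypotheses allow
to be expanded factor by factor. -/
theorem commutatorElement_commutatorElement_left {a b c h p q u v e : G} (hh : ⁅a, b⁆ = h)
    (hp : ⁅c, a⁆ = p) (hq : ⁅c, b⁆ = q) (hu : ⁅a, q⁆ = u⁻¹) (he : ⁅p, q⁆ = e)
    (hv : ⁅p, b⁆ = v⁻¹) (hqh : Commute q h) (hpu : Commute p u) (hph : Commute p h)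
    (hqv : Commute q v) (hhv : Commute h v) (hhe : Commute h e) (hue : Commute u e)
    (huv : Commute u v) : ⁅h, c⁆ = u * v * e⁻¹ := by
  have e₁ : c * h * c⁻¹ = ⁅p * a, q * b⁆ := by
    rw [← hh, conjugate_commutatorElement, ← hp, ← hq]
    congr 1 <;> simp [commutatorElement_def, mul_assoc]
  have e₂ : ⁅p * a, q * b⁆ = u⁻¹ * h * (e * v⁻¹) := by
    have e₃ : ⁅a, q * b⁆ = u⁻¹ * h := by
      rw [commutatorElement_mul_right_of_commute (by rwa [hh]), hu, hh]
    have e₄ : ⁅p, q * b⁆ = e * v⁻¹ := by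
      rw [commutatorElement_mul_right_of_commute (by rw [hv]; exact hqv.inv_right), he, hv]
    rw [commutatorElement_mul_left_of_commute (by rw [e₃]; exact hpu.inv_right.mul_right hph),
      e₃, e₄]
  rw [show ⁅h, c⁆ = h * (c * h * c⁻¹)⁻¹ by rw [commutatorElement_def]; group, e₁, e₂]
  have e₅ : Commute h (v * e⁻¹) := hhv.mul_right hhe.inv_right
  calc h * (u⁻¹ * h * (e * v⁻¹))⁻¹ = h * (v * e⁻¹) * h⁻¹ * u := by group
    _ = u * v * e⁻¹ := by
      rw [e₅.conj_eq, mul_assoc, ← hue.inv_right.eq, ← mul_assoc, huv.eq]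

end CommutatorIdentities

/-! ### Commutators in central extensions -/

namespace IsCentralExtension

variable {H : Type u} {G : Type v} [Group H] [Group G] {ε : H →* G} (hε : IsCentralExtension ε)
include hε

theorem commute_of_map_eq_one {z : H} (hz : ε z = 1) (p : H) : Commute z p :=
  (Subgroup.mem_center_iff.1 (hε.ker_le_center (MonoidHom.mem_ker.2 hz)) p).symm

theorem exists_eq_mul {p p' : H} (h : ε p = ε p') : ∃ z, (∀ r, Commute z r) ∧ p = z * p' :=
  ⟨p * p'⁻¹, hε.commute_of_map_eq_one (by simp [h]), by simp⟩

/-- Two lifts of an element differ by a central factor, which drops out of commutators. -/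
theorem commutatorElement_congr {p p' q q' : H} (hp : ε p = ε p') (hq : ε q = ε q') :
    ⁅p, q⁆ = ⁅p', q'⁆ := by
  obtain ⟨z, hz, rfl⟩ := hε.exists_eq_mul hp
  obtain ⟨w, hw, rfl⟩ := hε.exists_eq_mul hq
  rw [commutatorElement_mul_right_of_commute (hw _), (hw _).symm.commutator_eq, one_mul,
    commutatorElement_mul_left_of_commute (hz _), (hz _).commutator_eq, mul_one]

theorem commute_congr {p p' q q' : H} (hp : ε p = ε p') (hq : ε q = ε q') (h : Commute p q) :
    Commute p' q' := by
  rw [← commutatorElement_eq_one_iff_commute] at *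
  rw [← hε.commutatorElement_congr hp hq, h]

theorem conj_commutatorElement {p q r : H} (hq : Commute (ε p) (ε q))
    (hr : Commute (ε p) (ε r)) : Commute p ⁅q, r⁆ := by
  have : p * ⁅q, r⁆ * p⁻¹ = ⁅q, r⁆ := by
    rw [conjugate_commutatorElement]
    apply hε.commutatorElement_congr
    · simp [hq.eq]
    · simp [hr.eq]
  exact mul_inv_eq_iff_eq_mul.1 this

/-- Conjugation by `p` moves lifts of `g` and `h` only by central elements, so it fixes their
commutator, and `s` is that commutator up to a central factor. This is the source of all commutation
relations in `H`. -/
theorem commute_of_map_eq_commutatorElement {p s : H} {g h : G} (hs : ε s = ⁅g, h⁆)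
    (hg : Commute (ε p) g) (hh : Commute (ε p) h) : Commute p s := by
  obtain ⟨q, rfl⟩ := hε.surjective g
  obtain ⟨r, rfl⟩ := hε.surjective h
  exact hε.commute_congr rfl (by rw [hs, map_commutatorElement])
    (hε.conj_commutatorElement hg hh)

end IsCentralExtension

/-! ### Signs -/

namespace PseudoInvolution

variable {R : Type u} [Ring R] (P : PseudoInvolution R)

/-- The element `ε_i`, for an integer `i`. -/
noncomputable def sign (i : ℤ) : R := if 0 < i then P.oneInv else -1

theorem bar_oneInv : P.bar P.oneInv = P.bar 1 * P.bar 1 := by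
  have h := P.bar_mul' P.oneInv (P.bar 1)
  rw [P.oneInv_mul_bar_one, P.bar_bar, one_mul] at h
  calc P.bar P.oneInv = P.bar 1 * (P.oneInv * P.bar P.oneInv) := by
        rw [← mul_assoc, P.bar_one_mul_oneInv, one_mul]
    _ = _ := by rw [← h]

theorem sign_mul_sign_neg {i : ℤ} (hi : i ≠ 0) : P.sign i * P.sign (-i) = -P.oneInv := by
  rcases lt_or_gt_of_ne hi with h | h
  · rw [sign, sign, if_neg (by omega), if_pos (by omega), neg_one_mul]
  · rw [sign, sign, if_pos (by omega), if_neg (by omega), mul_neg_one]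

theorem sign_mul_bar_one_mul_sign_neg {i : ℤ} (hi : i ≠ 0) :
    P.sign i * P.bar 1 * P.sign (-i) = -1 := by
  rcases lt_or_gt_of_ne hi with h | h
  · rw [sign, sign, if_neg (by omega), if_pos (by omega), neg_one_mul, neg_mul,
      P.bar_one_mul_oneInv]
  · rw [sign, sign, if_pos (by omega), if_neg (by omega), mul_neg_one, P.oneInv_mul_bar_one]

theorem bar_sign_mul_sign (i : ℤ) : P.bar (P.sign i) * P.sign i = P.bar 1 := by
  rw [sign]
  split_ifs
  · rw [P.bar_oneInv, mul_assoc, P.bar_one_mul_oneInv, mul_one]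
  · simp

theorem oneInv_mul_bar_sign_mul_sign (i : ℤ) : P.oneInv * P.bar (P.sign i) * P.sign i = 1 := by
  rw [mul_assoc, P.bar_sign_mul_sign, P.oneInv_mul_bar_one]

theorem bar_sign_neg_mul {i : ℤ} (hi : i ≠ 0) (c : R) :
    P.bar (-(P.sign (-i) * P.bar 1 * c)) = P.bar c * P.sign i := by
  rcases lt_or_gt_of_ne hi with h | h
  · rw [sign, sign, if_pos (by omega), if_neg (by omega), P.oneInv_mul_bar_one, one_mul, map_neg,
      mul_neg_one]
  · rw [sign, sign, if_neg (by omega), if_pos (by omega), neg_mul, neg_mul, neg_neg, one_mul,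
      P.bar_mul', P.bar_bar, mul_one]

end PseudoInvolution

namespace OddFormParameter

variable {R : Type u} [Ring R] {P : PseudoInvolution R}
  {V : Type v} [AddCommGroup V] [Module Rᵐᵒᵖ V] {B : AntiHermitianForm P V}
  {L : OddFormParameter B}

/-! ### Elements of the odd form parameter -/

namespace Elt

theorem conj_conj (ξ : L.Elt) : ξ.conj.conj = ξ := by
  apply Subtype.ext
  ext
  · rfl
  · simp [conj, P.bar_bar]

theorem act_one (ξ : L.Elt) : ξ.act 1 = ξ := by
  apply Subtype.ext
  ext
  · simp [act, Heisenberg.act]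
  · simp [act, Heisenberg.act, P.bar_one_mul_oneInv]

theorem conj_act_conj (ξ : L.Elt) (b : R) : (ξ.conj.act b).conj = ξ.act b := by
  apply Subtype.ext
  ext
  · rfl
  · have h : P.oneInv * P.bar P.oneInv * P.oneInv = 1 := by
      rw [P.bar_oneInv, ← mul_assoc, P.oneInv_mul_bar_one, one_mul, P.bar_one_mul_oneInv]
    simp only [act, conj, Heisenberg.act, P.bar_mul', P.bar_bar, map_neg, mul_neg, neg_mul,
      neg_neg]
    calc _ = P.bar b * P.oneInv * ξ.1.scal * (P.oneInv * P.bar P.oneInv * P.oneInv) * b := by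
          simp only [mul_assoc]
      _ = _ := by rw [h, mul_one]

/-- The order is reversed because the form is anti-Hermitian: applying `-P.bar` to its value swaps
the arguments. -/
theorem conj_add (ξ ζ : L.Elt) : (ξ + ζ).conj = ζ.conj + ξ.conj := by
  apply Subtype.ext
  ext
  · simp [conj, add_comm]
  · simp only [conj, AddSubgroup.coe_add, Heisenberg.scal_add, map_add]
    rw [B.form_swap ζ.1.vec ξ.1.vec]
    abel

theorem scal_conj_act (ξ : L.Elt) (b : R) :
    (ξ.conj.act b).1.scal = -(P.bar b * P.oneInv * P.bar ξ.1.scal * b) := by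
  simp [conj, act, Heisenberg.act]

theorem scal_act (ξ : L.Elt) (b : R) :
    (ξ.act b).1.scal = P.bar b * P.oneInv * ξ.1.scal * b := rfl

end Elt

theorem add_eq_bracket_add (ξ ζ : L.Elt) : ξ + ζ = L.bracket ξ ζ + (ζ + ξ) := by
  apply Subtype.ext
  ext
  · simp [bracket, add_comm]
  · simp [bracket]
    abel

variable (L) in
/-- The element `(0, -ε_{-i} 1̄ c + c̄ ε_i)`. -/
noncomputable def hypElt (i : ℤ) (c : R) : L.Elt := L.trace (-(P.sign (-i) * P.bar 1 * c))

theorem scal_hypElt {i : ℤ} (hi : i ≠ 0) (c : R) :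
    (L.hypElt i c).1.scal = -(P.sign (-i) * P.bar 1 * c) + P.bar c * P.sign i := by
  rw [← P.bar_sign_neg_mul hi]; rfl

theorem conj_hypElt {i j : ℤ} (h : 0 < -i ↔ 0 < -j) (c : R) :
    (L.hypElt i c).conj = L.hypElt j (-c) := by
  apply Subtype.ext
  have hs : P.sign (-j) = P.sign (-i) := if_congr h.symm rfl rfl
  ext
  · rfl
  · simp only [Elt.conj, hypElt, trace, hs, mul_neg, map_neg, map_add, P.bar_bar]
    abel

/-- Only the product `a * b` enters, so `[x i j a, x j (-i) b]` behaves like a short commutator with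
opposite end indices. -/
theorem hyp_eq_hypElt {n : ℕ} (i : Omega n) (a b : R) : L.hyp i a b = L.hypElt i (a * b) := by
  apply Subtype.ext
  ext
  · rfl
  · rw [scal_hypElt i.2.1, P.bar_mul', ← mul_assoc]; rfl

/-! ### The Steinberg relations in a group -/

/-- `i` and `j` lie in `Ω` and `i ∉ {±j}`. -/
abbrev ApartIn (n : ℕ) (i j : ℤ) : Prop :=
  i ≠ 0 ∧ -n ≤ i ∧ i ≤ n ∧ j ≠ 0 ∧ -n ≤ j ∧ j ≤ n ∧ i ≠ j ∧ i ≠ -j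

variable (L) in
/-- The elements `x i j a` and `y i ξ` of a group satisfy the relations of the odd unitary
Steinberg group. -/
structure SteinbergRel (n : ℕ) {G : Type*} [Group G] (x : ℤ → ℤ → R → G)
    (y : ℤ → L.Elt → G) : Prop where
  symm : ∀ {i j}, ApartIn n i j → ∀ a, x i j a = x (-j) (-i) (P.sign (-j) * P.bar a * P.sign i)
  short_add : ∀ {i j}, ApartIn n i j → ∀ a b, x i j (a + b) = x i j a * x i j b
  long_add : ∀ {i : ℤ}, i ≠ 0 ∧ -n ≤ i ∧ i ≤ n → ∀ ξ ζ, y i (ξ + ζ) = y i ξ * y i ζ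
  commute_short : ∀ {i j h k}, ApartIn n i j → ApartIn n h k →
    h ≠ j ∧ h ≠ -i ∧ k ≠ i ∧ k ≠ -j → ∀ a b, Commute (x i j a) (x h k b)
  commute_long_short : ∀ {i j k : ℤ}, i ≠ 0 ∧ -n ≤ i ∧ i ≤ n → ApartIn n j k → j ≠ -i ∧ k ≠ i →
    ∀ ξ a, Commute (y i ξ) (x j k a)
  short_short : ∀ {i j k}, ApartIn n i j → ApartIn n j k → ApartIn n i k →
    ∀ a b, ⁅x i j a, x j k b⁆ = x i k (a * b)
  long_long : ∀ {i j}, ApartIn n i j → ∀ ξ ζ : L.Elt,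
    ⁅y i ξ, y j ζ⁆ = x i (-j) (P.sign i * B.form ξ.1.vec ζ.1.vec)
  long_self : ∀ {i : ℤ}, i ≠ 0 ∧ -n ≤ i ∧ i ≤ n → ∀ ξ ζ, ⁅y i ξ, y i ζ⁆ = y i (L.bracket ξ ζ)
  long_short : ∀ {i j}, ApartIn n i j → ∀ (ξ : L.Elt) b,
    ⁅y i ξ, x (-i) j b⁆ = x i j (P.sign i * ξ.1.scal * b) * y (-j) (ξ.conj.act b)
  short_short_neg : ∀ {i j}, ApartIn n i j → ∀ a b,
    ⁅x i j a, x j (-i) b⁆ = y i (L.hypElt i (a * b))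

/-- Pigeonhole: at most four absolute values are excluded from `1, …, 5`. This is where the bound `n
≥ 5` comes from. -/
theorem exists_apart (i j k l : ℤ) : ∃ m : ℤ, 0 < m ∧ m ≤ 5 ∧ (m ≠ i ∧ m ≠ -i) ∧
    (m ≠ j ∧ m ≠ -j) ∧ (m ≠ k ∧ m ≠ -k) ∧ (m ≠ l ∧ m ≠ -l) := by
  obtain ⟨m, hm, hm'⟩ := Finset.exists_mem_notMem_of_card_lt_card
    (s := ({|i|, |j|, |k|, |l|} : Finset ℤ)) (t := Finset.Icc 1 5)
    (lt_of_le_of_lt Finset.card_le_four (by simp))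
  rw [Finset.mem_Icc] at hm
  simp only [Finset.mem_insert, Finset.mem_singleton, not_or] at hm'
  have key : ∀ t : ℤ, ¬ m = |t| → m ≠ t ∧ m ≠ -t := fun t ht => by
    rcases abs_choice t with h | h <;> rw [h] at ht <;> have := abs_nonneg t <;> omega
  exact ⟨m, by omega, hm.2, key i hm'.1, key j hm'.2.1, key k hm'.2.2.1, key l hm'.2.2.2⟩

end OddFormParameter

namespace OddFormParameter

variable {R : Type u} [Ring R] {P : PseudoInvolution R}
  {V : Type v} [AddCommGroup V] [Module Rᵐᵒᵖ V] {B : AntiHermitianForm P V}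
  {L : OddFormParameter B}

namespace SteinbergRel

/-! ### Lifting the Steinberg relations to a central extension -/

variable {n : ℕ} {H G : Type*} [Group H] [Group G] {ε : H →* G} {x : ℤ → ℤ → R → G}
  {y : ℤ → L.Elt → G}

theorem lift_commute_short (S : L.SteinbergRel n x y) (hε : IsCentralExtension ε) (hn : 5 ≤ n)
    {i j h k : ℤ} (hij : ApartIn n i j) (hhk : ApartIn n h k)
    (hc : h ≠ j ∧ h ≠ -i ∧ k ≠ i ∧ k ≠ -j) {a b : R} {p q : H} (hp : ε p = x i j a)
    (hq : ε q = x h k b) : Commute p q := by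
  obtain ⟨m, hm⟩ := exists_apart i j h k
  refine hε.commute_of_map_eq_commutatorElement (g := x h m b) (h := x m k 1) ?_ ?_ ?_
  · rw [hq, S.short_short (by omega) (by omega) hhk, mul_one]
  · rw [hp]; exact S.commute_short hij (by omega) (by omega) _ _
  · rw [hp]; exact S.commute_short hij (by omega) (by omega) _ _

theorem lift_commute_long_short (S : L.SteinbergRel n x y) (hε : IsCentralExtension ε)
    (hn : 5 ≤ n) {i j k : ℤ} (hi : i ≠ 0 ∧ -n ≤ i ∧ i ≤ n) (hjk : ApartIn n j k)
    (hc : j ≠ -i ∧ k ≠ i) {ξ : L.Elt} {a : R} {p q : H} (hp : ε p = y i ξ)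
    (hq : ε q = x j k a) : Commute p q := by
  obtain ⟨m, hm⟩ := exists_apart i j k k
  refine hε.commute_of_map_eq_commutatorElement (g := x j m a) (h := x m k 1) ?_ ?_ ?_
  · rw [hq, S.short_short (by omega) (by omega) hjk, mul_one]
  · rw [hp]; exact S.commute_long_short hi (by omega) (by omega) _ _
  · rw [hp]; exact S.commute_long_short hi (by omega) (by omega) _ _

/-- With `r` over `x l k c`, both sides are bracketings of the triple `p', r, q`: `p` may be
replaced by `[p', r]` and `q'` by `[r, q]`, and Hall–Witt moves the bracket. The case `i = -j` is
included. -/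
theorem lift_short_short_shift (S : L.SteinbergRel n x y) (hε : IsCentralExtension ε)
    (hn : 5 ≤ n) {i j k l : ℤ} (hij : i ≠ j) (hik : ApartIn n i k) (hkj : ApartIn n k j)
    (hil : ApartIn n i l) (hlj : ApartIn n l j) (hkl : ApartIn n l k) {a b c : R}
    {p q p' q' : H} (hp : ε p = x i k (a * c)) (hq : ε q = x k j b) (hp' : ε p' = x i l a)
    (hq' : ε q' = x l j (c * b)) : ⁅p, q⁆ = ⁅p', q'⁆ := by
  obtain ⟨r, hr⟩ := hε.surjective (x l k c)
  have e₁ : ε ⁅p', r⁆ = x i k (a * c) := by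
    rw [map_commutatorElement, hp', hr, S.short_short hil hkl hik]
  have e₂ : ε ⁅r, q⁆ = x l j (c * b) := by
    rw [map_commutatorElement, hq, hr, S.short_short hkl hkj hlj]
  rw [hε.commutatorElement_congr (hp.trans e₁.symm) (rfl : ε q = ε q),
    hε.commutatorElement_congr (rfl : ε p' = ε p') (hq'.trans e₂.symm)]
  apply commutatorElement_assoc
  · exact S.lift_commute_short hε hn hil hkj (by omega) hp' hq
  · exact S.lift_commute_short hε hn hlj hik (by omega) e₂ e₁
  -- The outer commutator lies over a long generator if `i = -j` and over a short one otherwise.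
  · by_cases h : i = -j
    · obtain rfl : j = -i := by omega
      exact (S.lift_commute_long_short hε hn (i := i) (by omega) hlj (by omega)
        (by rw [map_commutatorElement, e₂, hp', S.short_short_neg hil]) e₂).symm
    · exact S.lift_commute_short hε hn hlj (h := i) (k := j) (by omega) (by omega) e₂
        (by rw [map_commutatorElement, e₂, hp', S.short_short hil hlj (by omega)])

/-- An index outside of `{±i, ±j}`. -/
noncomputable def freshIndex (i j : ℤ) : ℤ := (exists_apart i j i j).choose

theorem freshIndex_spec (i j : ℤ) : 0 < freshIndex i j ∧ freshIndex i j ≤ 5 ∧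
    (freshIndex i j ≠ i ∧ freshIndex i j ≠ -i) ∧ (freshIndex i j ≠ j ∧ freshIndex i j ≠ -j) :=
  let h := (exists_apart i j i j).choose_spec
  ⟨h.1, h.2.1, h.2.2.1, h.2.2.2.1⟩

/-- The lift of `x i j a` if `i ≠ ±j` and of `⁅x i k a, x k j 1⁆` if `i = -j`. -/
noncomputable def liftShort (hε : IsCentralExtension ε) (x : ℤ → ℤ → R → G) (i j : ℤ) (a : R) :
    H :=
  ⁅Function.surjInv hε.surjective (x i (freshIndex i j) a),
    Function.surjInv hε.surjective (x (freshIndex i j) j 1)⁆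

/-- Two shifts through an auxiliary index `l`: one from `k` to `l` with middle factor `1`, and one
between `l` and the chosen index `m` with middle factor `b`. The detour is needed since `k` may
equal `m` up to sign. -/
theorem commutatorElement_eq_liftShort (S : L.SteinbergRel n x y) (hε : IsCentralExtension ε)
    (hn : 5 ≤ n) {i j k : ℤ} (hij : i ≠ j) (hik : ApartIn n i k) (hkj : ApartIn n k j)
    {a b : R} {p q : H} (hp : ε p = x i k a) (hq : ε q = x k j b) :
    ⁅p, q⁆ = liftShort hε x i j (a * b) := by
  have hm := freshIndex_spec i j
  set m := freshIndex i j with hmdef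
  obtain ⟨l, hl⟩ := exists_apart i j k m
  have s := Function.surjInv_eq hε.surjective
  have e₁ : ⁅p, q⁆ = ⁅Function.surjInv hε.surjective (x i l a),
      Function.surjInv hε.surjective (x l j b)⁆ :=
    S.lift_short_short_shift hε hn hij hik hkj (l := l) (by omega) (by omega) (by omega)
      (c := 1) (by rw [hp, mul_one]) hq (s _) (by rw [s, one_mul])
  rw [e₁, liftShort, ← hmdef]
  exact (S.lift_short_short_shift hε hn hij (k := m) (l := l) (by omega) (by omega) (by omega)
    (by omega) (by omega) (c := b) (s _) (s _) (s _) (by rw [s, mul_one])).symm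

theorem map_liftShort (S : L.SteinbergRel n x y) (hε : IsCentralExtension ε) (hn : 5 ≤ n)
    {i j : ℤ} (hij : ApartIn n i j) (a : R) : ε (liftShort hε x i j a) = x i j a := by
  have hm := freshIndex_spec i j
  rw [liftShort, map_commutatorElement, Function.surjInv_eq hε.surjective, Function.surjInv_eq hε.surjective,
    S.short_short (by omega) (by omega) hij, mul_one]

theorem map_liftShort_neg (S : L.SteinbergRel n x y) (hε : IsCentralExtension ε) (hn : 5 ≤ n)
    {i : ℤ} (hi : i ≠ 0 ∧ -n ≤ i ∧ i ≤ n) (a : R) :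
    ε (liftShort hε x i (-i) a) = y i (L.hypElt i a) := by
  have hm := freshIndex_spec i (-i)
  rw [liftShort, map_commutatorElement, Function.surjInv_eq hε.surjective, Function.surjInv_eq hε.surjective,
    S.short_short_neg (by omega), mul_one]

theorem liftShort_mul (S : L.SteinbergRel n x y) (hε : IsCentralExtension ε) (hn : 5 ≤ n)
    {i j k : ℤ} (hij : i ≠ j) (hik : ApartIn n i k) (hkj : ApartIn n k j) (a b : R) :
    ⁅liftShort hε x i k a, liftShort hε x k j b⁆ = liftShort hε x i j (a * b) :=
  S.commutatorElement_eq_liftShort hε hn hij hik hkj (S.map_liftShort hε hn hik a)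
    (S.map_liftShort hε hn hkj b)

theorem liftShort_add (S : L.SteinbergRel n x y) (hε : IsCentralExtension ε) (hn : 5 ≤ n)
    {i j : ℤ} (hi : i ≠ 0 ∧ -n ≤ i ∧ i ≤ n) (hj : j ≠ 0 ∧ -n ≤ j ∧ j ≤ n) (hij : i ≠ j)
    (a b : R) : liftShort hε x i j (a + b) = liftShort hε x i j a * liftShort hε x i j b := by
  obtain ⟨m, hm⟩ := exists_apart i j i j
  have him : ApartIn n i m := by omega
  have hmj : ApartIn n m j := by omega
  have e : ∀ c, ⁅liftShort hε x i m c, liftShort hε x m j 1⁆ = liftShort hε x i j c :=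
    fun c => by rw [S.liftShort_mul hε hn hij him hmj, mul_one]
  -- `b` comes first because `commutatorElement_mul_left_of_commute` reverses the factors.
  have hadd : ε (liftShort hε x i m b * liftShort hε x i m a) = x i m (a + b) := by
    rw [map_mul, S.map_liftShort hε hn him, S.map_liftShort hε hn him, ← S.short_add him, add_comm]
  rw [← e a, ← e b, ← commutatorElement_mul_left_of_commute,
    S.commutatorElement_eq_liftShort hε hn hij him hmj hadd (S.map_liftShort hε hn hmj 1), mul_one]
  rw [e a]
  by_cases h : i = -j
  · obtain rfl : j = -i := by omega
    exact (S.lift_commute_long_short hε hn hi him (by omega) (S.map_liftShort_neg hε hn hi a)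
      (S.map_liftShort hε hn him b)).symm
  · have hij' : ApartIn n i j := by omega
    exact S.lift_commute_short hε hn him hij' (by omega) (S.map_liftShort hε hn him b)
      (S.map_liftShort hε hn hij' a)

theorem liftShort_neg (S : L.SteinbergRel n x y) (hε : IsCentralExtension ε) (hn : 5 ≤ n)
    {i j : ℤ} (hi : i ≠ 0 ∧ -n ≤ i ∧ i ≤ n) (hj : j ≠ 0 ∧ -n ≤ j ∧ j ≤ n) (hij : i ≠ j)
    (a : R) : liftShort hε x i j (-a) = (liftShort hε x i j a)⁻¹ := by
  have h0 := S.liftShort_add hε hn hi hj hij 0 0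
  rw [add_zero, left_eq_mul] at h0
  rw [eq_inv_iff_mul_eq_one, ← S.liftShort_add hε hn hi hj hij, neg_add_cancel, h0]

/-- Swapping the entries of the defining commutator inverts it. Rewriting both entries by the
symmetry in `G` brings in `P.sign m * P.sign (-m) = -P.oneInv`, whose minus sign undoes the
inversion. -/
theorem liftShort_symm (S : L.SteinbergRel n x y) (hε : IsCentralExtension ε) (hn : 5 ≤ n)
    {i j : ℤ} (hij : ApartIn n i j) (a : R) : liftShort hε x i j a =
      liftShort hε x (-j) (-i) (P.sign (-j) * P.bar a * P.sign i) := by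
  obtain ⟨m, hm⟩ := exists_apart i j i j
  have him : ApartIn n i m := by omega
  have hmj : ApartIn n m j := by omega
  have e : P.sign (-j) * P.bar 1 * P.sign m * (P.sign (-m) * P.bar a * P.sign i) =
      -(P.sign (-j) * P.bar a * P.sign i) := by
    calc _ = P.sign (-j) * (P.bar 1 * (P.sign m * P.sign (-m))) * P.bar a * P.sign i := by
          simp only [mul_assoc]
      _ = _ := by
        rw [P.sign_mul_sign_neg (by omega), mul_neg, P.bar_one_mul_oneInv]
        simp
  rw [← mul_one a, ← S.liftShort_mul hε hn hij.2.2.2.2.2.2.1 him hmj, ← commutatorElement_inv,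
    S.commutatorElement_eq_liftShort hε hn (i := -j) (k := -m) (j := -i) (by omega) (by omega)
      (by omega) ((S.map_liftShort hε hn hmj 1).trans (S.symm hmj 1))
      ((S.map_liftShort hε hn him a).trans (S.symm him a)), e,
    S.liftShort_neg hε hn (by omega) (by omega) (by omega), inv_inv, mul_one]

/-- Up to a short factor, `y j ζ` is a commutator of `y k ζ.conj` with `x (-k) (-j) 1`. Bracketing
first with `p` yields a short element, which reduces the claim to short commutators. -/
theorem lift_long_long (S : L.SteinbergRel n x y) (hε : IsCentralExtension ε) (hn : 5 ≤ n)
    {i j : ℤ} (hij : ApartIn n i j) {ξ ζ : L.Elt} {p q : H} (hp : ε p = y i ξ)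
    (hq : ε q = y j ζ) :
    ⁅p, q⁆ = liftShort hε x i (-j) (P.sign i * B.form ξ.1.vec ζ.1.vec) := by
  obtain ⟨k, hk⟩ := exists_apart i j i j
  have hkj : ApartIn n k (-j) := by omega
  have hkj' : ApartIn n (-k) (-j) := by omega
  have hij' : ApartIn n i (-j) := by omega
  have hik' : ApartIn n i (-k) := by omega
  obtain ⟨b, hb⟩ := hε.surjective (y k ζ.conj)
  obtain ⟨c, hc⟩ := hε.surjective (x (-k) (-j) 1)
  obtain ⟨t, ht⟩ := hε.surjective (x k (-j) (P.sign k * ζ.conj.1.scal * 1))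
  have hs : ε (t⁻¹ * ⁅b, c⁆) = y j ζ := by
    rw [map_mul, map_inv, ht, map_commutatorElement, hb, hc, S.long_short hkj, neg_neg,
      inv_mul_cancel_left, Elt.act_one, Elt.conj_conj]
  have hd : ε ⁅p, b⁆ = x i (-k) (P.sign i * B.form ξ.1.vec ζ.1.vec) := by
    rw [map_commutatorElement, hp, hb, S.long_long (by omega)]; rfl
  have hr : ⁅⁅p, b⁆, c⁆ = liftShort hε x i (-j) (P.sign i * B.form ξ.1.vec ζ.1.vec) := by
    rw [S.commutatorElement_eq_liftShort hε hn (by omega) hik' hkj' hd hc, mul_one]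
  rw [hε.commutatorElement_congr (rfl : ε p = ε p) (hq.trans hs.symm)]
  refine commutatorElement_eq_of_commutatorElement_eq_mul (b := b) (c := c) (t := t) ?_ ?_ ?_ hr
    ?_ ?_ ?_
  · exact S.lift_commute_long_short hε hn (by omega) hkj' (by omega) hp hc
  · rw [mul_inv_cancel_left]
  · exact S.lift_commute_long_short hε hn (by omega) hkj (by omega) hp ht
  · exact S.lift_commute_short hε hn hik' hkj (by omega) hd ht
  · exact (S.lift_commute_long_short hε hn (by omega) hik' (by omega) hs hd).symm
  · exact (S.lift_commute_long_short hε hn (by omega) hij' (by omega) hs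
      (S.map_liftShort hε hn hij' _)).symm

end SteinbergRel

end OddFormParameter

/-! ### Lifts of the long generators -/

namespace OddFormParameter

variable {R : Type u} [Ring R] {P : PseudoInvolution R}
  {V : Type v} [AddCommGroup V] [Module Rᵐᵒᵖ V] {B : AntiHermitianForm P V}
  {L : OddFormParameter B}

namespace SteinbergRel

variable {n : ℕ} {H G : Type*} [Group H] [Group G] {ε : H →* G} {x : ℤ → ℤ → R → G}
  {y : ℤ → L.Elt → G}

/-- A lift of `y (-j) (ξ.conj.act b)`. -/
noncomputable def preLiftLong (hε : IsCentralExtension ε) (x : ℤ → ℤ → R → G)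
    (y : ℤ → L.Elt → G) (i j : ℤ) (ξ : L.Elt) (b : R) : H :=
  (liftShort hε x i j (P.sign i * ξ.1.scal * b))⁻¹ *
    ⁅Function.surjInv hε.surjective (y i ξ), liftShort hε x (-i) j b⁆

theorem commutatorElement_eq_mul_preLiftLong (hε : IsCentralExtension ε) {i j : ℤ} {ξ : L.Elt}
    {b : R} {p : H} (hp : ε p = y i ξ) : ⁅p, liftShort hε x (-i) j b⁆ =
      liftShort hε x i j (P.sign i * ξ.1.scal * b) * preLiftLong hε x y i j ξ b := by
  rw [preLiftLong, mul_inv_cancel_left, hε.commutatorElement_congr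
    (hp.trans (Function.surjInv_eq hε.surjective _).symm) (rfl : ε (liftShort hε x (-i) j b) = _)]

theorem map_preLiftLong (S : L.SteinbergRel n x y) (hε : IsCentralExtension ε) (hn : 5 ≤ n)
    {i j : ℤ} (hij : ApartIn n i j) (ξ : L.Elt) (b : R) :
    ε (preLiftLong hε x y i j ξ b) = y (-j) (ξ.conj.act b) := by
  rw [preLiftLong, map_mul, map_inv, map_commutatorElement, S.map_liftShort hε hn hij,
    S.map_liftShort hε hn (by omega), Function.surjInv_eq hε.surjective, S.long_short hij,
    inv_mul_cancel_left]

/-- Factor `x (-i) j b` through the index `-k` and bracket with a lift of `y i ξ`. The right side no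
longer contains `i`, and it involves `ξ` and `b` only through `ξ.conj.act b`, since `ξ.act b` is the
`conj` of that element. -/
theorem preLiftLong_eq_mul (S : L.SteinbergRel n x y) (hε : IsCentralExtension ε) (hn : 5 ≤ n)
    {i j k : ℤ} (hij : ApartIn n i j) (hkj : ApartIn n k j) (hik : ApartIn n i k) (ξ : L.Elt)
    (b : R) : preLiftLong hε x y i j ξ b = preLiftLong hε x y k j (ξ.conj.act b) 1 *
      liftShort hε x (-j) j (-(P.sign (-j) * (ξ.act b).1.scal)) := by
  have hij' : ApartIn n (-i) j := by omega
  have hkj' : ApartIn n (-k) j := by omega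
  have hik' : ApartIn n (-i) (-k) := by omega
  have hik'' : ApartIn n i (-k) := by omega
  obtain ⟨a, ha⟩ := hε.surjective (y i ξ)
  set p := liftShort hε x i (-k) (P.sign i * ξ.1.scal * b) with hp
  set d := liftShort hε x (-i) (-k) b with hd
  set c := liftShort hε x (-k) j (1 : R) with hc
  set t := liftShort hε x i j (P.sign i * ξ.1.scal * b) with ht
  set m := liftShort hε x (-i) j b with hm
  set s := preLiftLong hε x y k j (ξ.conj.act b) 1 with hs
  have hpε : ε p = x i (-k) (P.sign i * ξ.1.scal * b) := S.map_liftShort hε hn hik'' _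
  have hcε : ε c = x (-k) j 1 := S.map_liftShort hε hn hkj' _
  have htε : ε t = x i j (P.sign i * ξ.1.scal * b) := S.map_liftShort hε hn hij _
  have hmε : ε m = x (-i) j b := S.map_liftShort hε hn hij' _
  have hsε : ε s = y (-j) (ξ.act b) := by
    rw [hs, S.map_preLiftLong hε hn hkj, Elt.act_one, Elt.conj_act_conj]
  have hq : ε (p⁻¹ * ⁅a, d⁆) = y k (ξ.conj.act b) := by
    rw [map_mul, map_inv, map_commutatorElement, ha, hpε, hd, S.map_liftShort hε hn hik',
      S.long_short hik'', inv_mul_cancel_left, neg_neg]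
  have e₁ : P.sign k * P.bar (P.sign i * ξ.1.scal * b) * P.sign i * b =
      -(P.sign k * (ξ.conj.act b).1.scal * 1) := by
    rw [Elt.scal_conj_act, mul_one, mul_neg, neg_neg, P.bar_mul', P.bar_mul']
    calc _ = P.sign k * P.bar b * P.oneInv * P.bar ξ.1.scal *
          (P.oneInv * P.bar (P.sign i) * P.sign i) * b := by simp only [mul_assoc]
      _ = _ := by rw [P.oneInv_mul_bar_sign_mul_sign, mul_one]; simp only [mul_assoc]
  -- This is inverse to the short factor of the commutator of `c` with the lift of `y k (ξ.conj.act
  -- b)`, so the two cancel.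
  have hn' : ⁅p, m⁆ = (liftShort hε x k j (P.sign k * (ξ.conj.act b).1.scal * 1))⁻¹ := by
    rw [S.commutatorElement_eq_liftShort hε hn hkj.2.2.2.2.2.2.1 (k := -i) (by omega) hij'
      (hpε.trans ((S.symm hik'' _).trans (by rw [neg_neg]))) hmε, e₁,
      S.liftShort_neg hε hn (by omega) (by omega) (by omega)]
  have hnε : ε (liftShort hε x k j (P.sign k * (ξ.conj.act b).1.scal * 1))⁻¹ =
      x k j (-(P.sign k * (ξ.conj.act b).1.scal * 1)) := by
    rw [← S.liftShort_neg hε hn (by omega) (by omega) (by omega), S.map_liftShort hε hn hkj]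
  have hmt : ⁅m, t⁆ = liftShort hε x (-j) j (-(P.sign (-j) * (ξ.act b).1.scal)) := by
    rw [S.commutatorElement_eq_liftShort hε hn (i := -j) (k := i) (by omega) (by omega) hij
      (hmε.trans ((S.symm hij' _).trans (by rw [neg_neg]))) htε]
    congr 1
    calc _ = P.sign (-j) * P.bar b * (P.sign (-i) * P.sign (- -i)) * ξ.1.scal * b := by
          rw [neg_neg]; simp only [mul_assoc]
      _ = _ := by
        rw [P.sign_mul_sign_neg (by omega)]
        simp [Elt.scal_act, mul_assoc]
  have hmtε : ε ⁅m, t⁆ = y (-j) (L.hypElt (-j) (-(P.sign (-j) * (ξ.act b).1.scal))) := by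
    have := S.map_liftShort_neg hε hn (i := -j) (by omega) (-(P.sign (-j) * (ξ.act b).1.scal))
    rw [hmt]
    rwa [neg_neg] at this
  rw [← hmt, ← inv_mul_commutatorElement_commutatorElement (a := a) (b := d) (c := c) (p := p)
    (q := p⁻¹ * ⁅a, d⁆) (m := m) (s := s) (t := t) ?_ ?_ ?_ ?_ hn' ?_ ?_ ?_ ?_ ?_ ?_ ?_ ?_,
    commutatorElement_eq_mul_preLiftLong hε ha, inv_mul_cancel_left]
  · exact S.lift_commute_long_short hε hn (by omega) hkj' (by omega) ha hcε
  · rw [hd, hc, S.liftShort_mul hε hn (by omega) hik' hkj', mul_one]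
  · rw [mul_inv_cancel_left]
  · exact S.lift_commute_long_short hε hn (by omega) hij' (by omega) hq hmε
  · rw [inv_inv]
    exact commutatorElement_eq_mul_preLiftLong hε hq
  · rw [S.commutatorElement_eq_liftShort hε hn (by omega) hik'' hkj' hpε hcε, mul_one]
  · exact S.lift_commute_short hε hn hik'' hkj (by omega) hpε hnε
  · exact (S.lift_commute_long_short hε hn (by omega) hik'' (by omega) hsε hpε).symm
  · exact S.lift_commute_short hε hn hkj hij' (by omega) hnε hmε
  · exact (S.lift_commute_long_short hε hn (by omega) hij' (by omega) hsε hmε).symm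
  · exact (S.lift_commute_long_short hε hn (by omega) hij (by omega) hsε htε).symm
  · exact (S.lift_commute_long_short hε hn (by omega) hij (by omega) hmtε htε).symm

/-- The lift of `y i ξ`. -/
noncomputable def liftLong (hε : IsCentralExtension ε) (x : ℤ → ℤ → R → G)
    (y : ℤ → L.Elt → G) (i : ℤ) (ξ : L.Elt) : H :=
  preLiftLong hε x y (freshIndex i i) (-i) ξ.conj 1

/-- Both sides are rewritten by `preLiftLong_eq_mul` through one common `k`, after which they
coincide. -/
theorem preLiftLong_eq_liftLong (S : L.SteinbergRel n x y) (hε : IsCentralExtension ε)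
    (hn : 5 ≤ n) {i j : ℤ} (hij : ApartIn n i j) (ξ : L.Elt) (b : R) :
    preLiftLong hε x y i j ξ b = liftLong hε x y (-j) (ξ.conj.act b) := by
  have hm := freshIndex_spec (-j) (-j)
  rw [liftLong, neg_neg]
  set m := freshIndex (-j) (-j)
  obtain ⟨k, hk⟩ := exists_apart i j m m
  rw [S.preLiftLong_eq_mul hε hn (k := k) hij (by omega) (by omega),
    S.preLiftLong_eq_mul hε hn (i := m) (k := k) (by omega) (by omega) (by omega),
    Elt.act_one, Elt.act_one, Elt.conj_conj, Elt.conj_act_conj]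

theorem map_liftLong (S : L.SteinbergRel n x y) (hε : IsCentralExtension ε) (hn : 5 ≤ n)
    {i : ℤ} (hi : i ≠ 0 ∧ -n ≤ i ∧ i ≤ n) (ξ : L.Elt) : ε (liftLong hε x y i ξ) = y i ξ := by
  have hm := freshIndex_spec i i
  rw [liftLong, S.map_preLiftLong hε hn (by omega), neg_neg, Elt.act_one, Elt.conj_conj]

theorem lift_long_short (S : L.SteinbergRel n x y) (hε : IsCentralExtension ε) (hn : 5 ≤ n)
    {i j : ℤ} (hij : ApartIn n i j) (ξ : L.Elt) (b : R) {p : H} (hp : ε p = y i ξ) :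
    ⁅p, liftShort hε x (-i) j b⁆ = liftShort hε x i j (P.sign i * ξ.1.scal * b) *
      liftLong hε x y (-j) (ξ.conj.act b) := by
  rw [commutatorElement_eq_mul_preLiftLong hε hp, S.preLiftLong_eq_liftLong hε hn hij]

/-- The commutator of `liftShort hε x i (-i) c` with a lift of `x (-i) j 1` is computed twice: from
the first entry as a commutator of short elements, and from its image as a long generator.
Comparison leaves the two candidate lifts at `-j`. -/
theorem liftLong_hypElt (S : L.SteinbergRel n x y) (hε : IsCentralExtension ε) (hn : 5 ≤ n)
    {i : ℤ} (hi : i ≠ 0 ∧ -n ≤ i ∧ i ≤ n) (a : R) :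
    liftLong hε x y i (L.hypElt i a) = liftShort hε x i (-i) a := by
  obtain ⟨j, rfl⟩ : ∃ j, i = -j := ⟨-i, (neg_neg i).symm⟩
  obtain ⟨c, rfl⟩ : ∃ c, a = -c := ⟨-a, (neg_neg a).symm⟩
  -- With equal signs, `P.sign i = P.sign (-j)`; hence the lift of `x (-i) j 1` is that of `x (-j) i
  -- (-1)`, and `conj_hypElt` applies.
  obtain ⟨i, hij, hsgn⟩ : ∃ i, ApartIn n i j ∧ (0 < i ↔ 0 < -j) := by
    obtain ⟨m, hm⟩ := exists_apart j j j j
    rcases lt_or_gt_of_ne hi.1 with h | h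
    · exact ⟨-m, by omega, by omega⟩
    · exact ⟨m, by omega, by omega⟩
  have hs : P.sign (-j) = P.sign i := if_congr hsgn.symm rfl rfl
  obtain ⟨k, hk⟩ := exists_apart i j i j
  have hik : ApartIn n i k := by omega
  have hki : ApartIn n k (-i) := by omega
  have hkj : ApartIn n k j := by omega
  have hij' : ApartIn n (-i) j := by omega
  have hji : ApartIn n (-j) i := by omega
  have hji' : ApartIn n (-j) (-i) := by omega
  have hjk : ApartIn n (-j) k := by omega
  have hhε := S.map_liftShort_neg hε hn (i := i) (by omega) c
  have heε := S.map_liftShort_neg hε hn (i := -j) (by omega) c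
  rw [neg_neg] at heε ⊢
  have hc : liftShort hε x (-i) j 1 = liftShort hε x (-j) i (P.sign i * P.bar 1 * P.sign (-i)) := by
    rw [S.liftShort_symm hε hn hij', neg_neg, hs]
  rw [P.sign_mul_bar_one_mul_sign_neg (by omega)] at hc
  have key : ⁅liftShort hε x i (-i) c, liftShort hε x (-i) j 1⁆ =
      liftShort hε x i j c * liftShort hε x (-j) (-i) c * (liftShort hε x (-j) j c)⁻¹ := by
    refine commutatorElement_commutatorElement_left (a := liftShort hε x i k c)
      (b := liftShort hε x k (-i) 1) (p := liftShort hε x (-j) k (-c))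
      (q := liftShort hε x k j (-1)) ?_ ?_ ?_ ?_ ?_ ?_ ?_ ?_ ?_ ?_ ?_ ?_ ?_ ?_
    · rw [S.liftShort_mul hε hn (by omega) hik hki, mul_one]
    · rw [hc, S.liftShort_mul hε hn (by omega) hji hik, neg_one_mul]
    · rw [← commutatorElement_inv, S.liftShort_mul hε hn (by omega) hki hij', mul_one,
        S.liftShort_neg hε hn (by omega) (by omega) (by omega)]
    · rw [S.liftShort_mul hε hn (by omega) hik hkj, mul_neg_one,
        S.liftShort_neg hε hn (by omega) (by omega) (by omega)]
    · rw [S.liftShort_mul hε hn (by omega) hjk hkj, mul_neg_one, neg_neg]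
    · rw [S.liftShort_mul hε hn (by omega) hjk hki, mul_one,
        S.liftShort_neg hε hn (by omega) (by omega) (by omega)]
    · exact (S.lift_commute_long_short hε hn (by omega) hkj (by omega) hhε
        (S.map_liftShort hε hn hkj _)).symm
    · exact S.lift_commute_short hε hn hjk hij (by omega) (S.map_liftShort hε hn hjk _)
        (S.map_liftShort hε hn hij _)
    · exact (S.lift_commute_long_short hε hn (by omega) hjk (by omega) hhε
        (S.map_liftShort hε hn hjk _)).symm
    · exact S.lift_commute_short hε hn hkj hji' (by omega) (S.map_liftShort hε hn hkj _)
        (S.map_liftShort hε hn hji' _)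
    · exact S.lift_commute_long_short hε hn (by omega) hji' (by omega) hhε
        (S.map_liftShort hε hn hji' _)
    · refine hε.commute_of_map_eq_commutatorElement (g := x (-j) k c) (h := x k j 1) ?_ ?_ ?_
      · have := S.short_short_neg hjk c 1
        rw [neg_neg, mul_one] at this
        rw [heε, this]
      · rw [hhε]; exact S.commute_long_short (by omega) hjk (by omega) _ _
      · rw [hhε]; exact S.commute_long_short (by omega) hkj (by omega) _ _
    · exact (S.lift_commute_long_short hε hn (by omega) hij (by omega) heε
        (S.map_liftShort hε hn hij _)).symm
    · exact S.lift_commute_short hε hn hij hji' (by omega) (S.map_liftShort hε hn hij _)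
        (S.map_liftShort hε hn hji' _)
  have hscal : P.sign i * (L.hypElt i c).1.scal * 1 = c + P.sign i * P.bar c * P.sign i := by
    rw [scal_hypElt hij.1, mul_one, mul_add, mul_neg, ← mul_assoc, ← mul_assoc,
      ← mul_assoc, P.sign_mul_sign_neg hij.1, neg_mul, P.oneInv_mul_bar_one, neg_one_mul, neg_neg]
  have hsymm : liftShort hε x (-j) (-i) c = liftShort hε x i j (P.sign i * P.bar c * P.sign i) := by
    rw [S.liftShort_symm hε hn hji', neg_neg, neg_neg, hs]
  have e := S.lift_long_short hε hn hij (L.hypElt i c) 1 hhε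
  rw [key, hsymm, hscal, S.liftShort_add hε hn (by omega) (by omega) (by omega), mul_right_inj,
    Elt.act_one, conj_hypElt (j := -j) (by omega)] at e
  rw [← e, S.liftShort_neg hε hn (by omega) (by omega) (by omega)]

/-- Bracket the lift of `x (-i) j 1` with the product of the lifts of `y i ζ` and `y i ξ`, once
factor by factor and once as an element over `y i (ζ + ξ)`. The commutator of `y i ζ` with `y (-j)
ξ.conj` accounts for the form term in the scalar part of `ζ + ξ`, so the short factors cancel. The
reversed order is restored by `Elt.conj_add`. -/
theorem liftLong_add (S : L.SteinbergRel n x y) (hε : IsCentralExtension ε) (hn : 5 ≤ n)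
    {i : ℤ} (hi : i ≠ 0 ∧ -n ≤ i ∧ i ≤ n) (ξ ζ : L.Elt) :
    liftLong hε x y i (ξ + ζ) = liftLong hε x y i ξ * liftLong hε x y i ζ := by
  obtain ⟨j, rfl⟩ : ∃ j, i = -j := ⟨-i, (neg_neg i).symm⟩
  obtain ⟨ζ, rfl⟩ : ∃ ζ' : L.Elt, ζ = ζ'.conj := ⟨ζ.conj, ζ.conj_conj.symm⟩
  obtain ⟨ξ, rfl⟩ : ∃ ξ' : L.Elt, ξ = ξ'.conj := ⟨ξ.conj, ξ.conj_conj.symm⟩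
  obtain ⟨i, hi'⟩ := exists_apart j j j j
  have hij : ApartIn n i j := by omega
  have hY := fun ξ => S.map_liftLong hε hn (i := i) (by omega) ξ
  have hX := fun a => S.map_liftShort hε hn hij a
  have e₁ := fun ξ => S.lift_long_short hε hn hij ξ 1 (hY ξ)
  simp only [mul_one, Elt.act_one] at e₁
  have e₂ := S.lift_long_short hε hn hij (ζ + ξ) 1
    (p := liftLong hε x y i ζ * liftLong hε x y i ξ)
    (by rw [map_mul, hY, hY, S.long_add (by omega)])
  have e₃ := S.lift_long_long hε hn (i := i) (j := -j) (by omega) (hY ζ)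
    (S.map_liftLong hε hn (i := -j) (by omega) ξ.conj)
  rw [neg_neg] at e₃
  have hcomm : Commute (liftLong hε x y (-j) ξ.conj) (liftShort hε x i j (P.sign i * ζ.1.scal)) :=
    S.lift_commute_long_short hε hn (by omega) hij (by omega)
      (S.map_liftLong hε hn (by omega) _) (hX _)
  have hcomm' : Commute (liftLong hε x y i ζ) (liftShort hε x i j (P.sign i * ξ.1.scal)) :=
    S.lift_commute_long_short hε hn (by omega) hij (by omega) (hY _) (hX _)
  have e₄ : liftLong hε x y i ζ * liftLong hε x y (-j) ξ.conj * (liftLong hε x y i ζ)⁻¹ =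
      liftShort hε x i j (P.sign i * B.form ζ.1.vec ξ.conj.1.vec) *
        liftLong hε x y (-j) ξ.conj := by
    rw [← e₃, commutatorElement_def, inv_mul_cancel_right]
  have e₅ : P.sign i * (ζ + ξ).1.scal = P.sign i * ξ.1.scal +
      P.sign i * B.form ζ.1.vec ξ.conj.1.vec + P.sign i * ζ.1.scal := by
    simp only [AddSubgroup.coe_add, Heisenberg.scal_add, Elt.conj, mul_add]
    abel
  have e₆ : liftLong hε x y i ζ * (liftShort hε x i j (P.sign i * ξ.1.scal) *
      liftLong hε x y (-j) ξ.conj) * (liftLong hε x y i ζ)⁻¹ =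
      liftShort hε x i j (P.sign i * ξ.1.scal) *
      (liftLong hε x y i ζ * liftLong hε x y (-j) ξ.conj * (liftLong hε x y i ζ)⁻¹) := by
    rw [← mul_assoc, hcomm'.eq]; simp only [mul_assoc]
  rw [commutatorElement_mul_left_eq_conj_mul, e₁, e₁, mul_one, Elt.act_one, Elt.conj_add, e₅,
    S.liftShort_add hε hn (by omega) (by omega) (by omega),
    S.liftShort_add hε hn (by omega) (by omega) (by omega), e₆, e₄] at e₂
  simp only [mul_assoc] at e₂
  rw [← mul_assoc (liftLong hε x y (-j) ξ.conj), hcomm.eq, mul_assoc, mul_right_inj,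
    mul_right_inj, mul_right_inj] at e₂
  exact e₂.symm

/-- The Steinberg relations lift to central extensions. -/
theorem lift (S : L.SteinbergRel n x y) (hε : IsCentralExtension ε) (hn : 5 ≤ n) :
    L.SteinbergRel n (liftShort hε x) (liftLong hε x y) where
  symm hij a := S.liftShort_symm hε hn hij a
  short_add hij a b := S.liftShort_add hε hn (by omega) (by omega) (by omega) a b
  long_add hi ξ ζ := S.liftLong_add hε hn hi ξ ζ
  commute_short hij hhk hc a b := S.lift_commute_short hε hn hij hhk hc
    (S.map_liftShort hε hn hij a) (S.map_liftShort hε hn hhk b)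
  commute_long_short hi hjk hc ξ a := S.lift_commute_long_short hε hn hi hjk hc
    (S.map_liftLong hε hn hi ξ) (S.map_liftShort hε hn hjk a)
  short_short hij hjk hik a b := S.liftShort_mul hε hn (by omega) hij hjk a b
  long_long hij ξ ζ := S.lift_long_long hε hn hij (S.map_liftLong hε hn (by omega) ξ)
    (S.map_liftLong hε hn (by omega) ζ)
  long_self {i} hi ξ ζ := by
    -- The bracket is already the commutator in the odd form parameter, so additivity alone gives
    -- this relation.
    have h := congrArg (liftLong hε x y i) (add_eq_bracket_add ξ ζ)
    simp only [S.liftLong_add hε hn hi] at h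
    rw [commutatorElement_def, h]
    group
  long_short hij ξ b := S.lift_long_short hε hn hij ξ b (S.map_liftLong hε hn (by omega) ξ)
  short_short_neg hij a b := by
    rw [S.liftShort_mul hε hn (by omega) hij (by omega), S.liftLong_hypElt hε hn (by omega)]

end SteinbergRel

end OddFormParameter

/-! ### Universal central extensions -/

/-- The two homomorphisms agree on commutators by `commutatorElement_congr`, and these generate `K`.
-/
theorem IsCentralExtension.hom_eq_of_comp_eq {H : Type*} {G : Type*} {K : Type*} [Group H]
    [Group G] [Group K] [Group.IsPerfect K] {ε : H →* G} (hε : IsCentralExtension ε)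
    {f g : K →* H} (h : ε.comp f = ε.comp g) : f = g := by
  have hc : commutator K ≤ f.eqLocus g := by
    rw [commutator_eq_closure, Subgroup.closure_le]
    rintro _ ⟨a, b, rfl⟩
    change f ⁅a, b⁆ = g ⁅a, b⁆
    rw [map_commutatorElement, map_commutatorElement]
    exact hε.commutatorElement_congr (DFunLike.congr_fun h a) (DFunLike.congr_fun h b)
  ext a
  exact hc Group.IsPerfect.mem_commutator

theorem isCentralExtension_id (G : Type*) [Group G] : IsCentralExtension (MonoidHom.id G) where
  surjective := Function.surjective_id
  ker_le_center := by
    intro g hg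
    rw [show g = 1 from hg]
    exact one_mem _

theorem isCentrallyClosed_of_exists_section {G : Type v} [Group G] (hG : Group.IsPerfect G)
    (h : ∀ (H : Type w) [Group H] (ε : H →* G), IsCentralExtension ε →
      ∃ η : G →* H, ε.comp η = MonoidHom.id G) : IsCentrallyClosed.{v, w} G where
  isPerfect := hG
  isUniversal :=
    { isCentralExtension := isCentralExtension_id G
      existsUnique_lift := fun H _ ε hε => by
        obtain ⟨η, hη⟩ := h H ε hε
        exact ⟨η, hη, fun η' hη' => hε.hom_eq_of_comp_eq (hη'.trans hη.symm)⟩ }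

/-- Lifting the identity gives a section `σ` of `π`. Both `σ ∘ π` and the identity of `U` lift `π`
along itself, so they are equal and `π` is injective. -/
theorem IsCentrallyClosed.ker_eq_bot {G : Type v} [Group G] (hG : IsCentrallyClosed.{v, w} G)
    {U : Type w} [Group U] {π : U →* G} (hπ : IsUniversalCentralExtension.{w, v, w} π) :
    π.ker = ⊥ := by
  obtain ⟨σ, hσ, -⟩ := hG.isUniversal.existsUnique_lift U π hπ.isCentralExtension
  have h : σ.comp π = MonoidHom.id U :=
    (hπ.existsUnique_lift U π hπ.isCentralExtension).unique
      (by rw [← MonoidHom.comp_assoc, hσ, MonoidHom.id_comp]) (MonoidHom.comp_id π)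
  rw [MonoidHom.ker_eq_bot_iff]
  exact Function.LeftInverse.injective (DFunLike.congr_fun h)

namespace OddFormParameter

variable {R : Type u} [Ring R] {P : PseudoInvolution R}
  {V : Type v} [AddCommGroup V] [Module Rᵐᵒᵖ V] {B : AntiHermitianForm P V}
  {L : OddFormParameter B} {n : ℕ}

/-! ### The generators of the Steinberg group -/

theorem ApartIn.coe {i j : Omega n} (h : Omega.Apart i j) : ApartIn n i j := by
  rw [Omega.apart_iff] at h
  have hi := abs_le.1 i.2.2
  have hj := abs_le.1 j.2.2
  exact ⟨i.2.1, hi.1, hi.2, j.2.1, hj.1, hj.2, h⟩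

theorem apart_mk {i j : ℤ} (h : ApartIn n i j) : Omega.Apart
    (⟨i, h.1, abs_le.2 ⟨h.2.1, h.2.2.1⟩⟩ : Omega n)
    ⟨j, h.2.2.2.1, abs_le.2 ⟨h.2.2.2.2.1, h.2.2.2.2.2.1⟩⟩ :=
  Omega.apart_iff.2 h.2.2.2.2.2.2

variable (L n) in
/-- The projection from the free group to the Steinberg group. -/
def stMk : FreeGroup (L.Gen n) →* L.StU n := PresentedGroup.mk _

theorem stMk_surjective : Function.Surjective (stMk L n) := PresentedGroup.mk_surjective _

open Classical in
variable (L n) in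
/-- The generator `X_{ij}(a)` of the Steinberg group. -/
noncomputable def stX (i j : ℤ) (a : R) : L.StU n :=
  if h : ApartIn n i j then stMk L n (L.X _ _ (apart_mk h) a) else 1

open Classical in
variable (L n) in
/-- The generator `X_i(ξ)` of the Steinberg group. -/
noncomputable def stY (i : ℤ) (ξ : L.Elt) : L.StU n :=
  if h : i ≠ 0 ∧ |i| ≤ n then stMk L n (L.Y ⟨i, h⟩ ξ) else 1

theorem stMk_X {i j : Omega n} (h : Omega.Apart i j) (a : R) :
    stMk L n (L.X i j h a) = stX L n i j a := by
  rw [stX, dif_pos (ApartIn.coe h)]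

theorem stMk_Y (i : Omega n) (ξ : L.Elt) :
    stMk L n (L.Y i ξ) = stY L n i ξ := by
  rw [stY, dif_pos i.2]

theorem stMk_eq_stMk {a b : FreeGroup (L.Gen n)} (h : L.Rel n a b) : stMk L n a = stMk L n b := by
  have h1 : stMk L n (a * b⁻¹) = 1 :=
    (QuotientGroup.eq_one_iff _).2 (Subgroup.subset_normalClosure ⟨a, b, h, rfl⟩)
  rw [map_mul, map_inv] at h1
  exact mul_inv_eq_one.1 h1

theorem exists_comp_stMk_eq {G : Type*} [Group G] (φ : FreeGroup (L.Gen n) →* G)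
    (h : ∀ a b, L.Rel n a b → φ a = φ b) : ∃ f : L.StU n →* G, f.comp (stMk L n) = φ := by
  refine ⟨PresentedGroup.toGroup (f := fun g => φ (FreeGroup.of g)) ?_, ?_⟩
  · rintro _ ⟨a, b, hab, rfl⟩
    rw [show FreeGroup.lift (fun g => φ (FreeGroup.of g)) = φ from
      FreeGroup.ext_hom _ _ fun g => FreeGroup.lift_apply_of, map_mul, map_inv, h a b hab,
      mul_inv_cancel]
  · exact FreeGroup.ext_hom _ _ fun g => FreeGroup.lift_apply_of

theorem ApartIn.exists_coe {i j : ℤ} (h : ApartIn n i j) :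
    ∃ i' j' : Omega n, i = i' ∧ j = j' ∧ Omega.Apart i' j' := ⟨_, _, rfl, rfl, apart_mk h⟩

theorem exists_omega_coe {i : ℤ} (h : i ≠ 0 ∧ -n ≤ i ∧ i ≤ n) : ∃ i' : Omega n, i = i' :=
  ⟨⟨i, h.1, abs_le.2 h.2⟩, rfl⟩

-- Every relation assumes its indices lie in `Ω`, so the default value `1` of `stX` and `stY` never
-- enters.
variable (L n) in
theorem steinbergRel_stU : L.SteinbergRel n (stX L n) (stY L n) where
  symm hij a := by
    obtain ⟨i, j, rfl, rfl, h⟩ := hij.exists_coe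
    simp only [← Omega.coe_neg, ← stMk_X h, ← stMk_X h.neg_swap]
    exact stMk_eq_stMk (.r0 i j h a)
  short_add hij a b := by
    obtain ⟨i, j, rfl, rfl, h⟩ := hij.exists_coe
    simp only [← stMk_X h, ← map_mul]
    exact (stMk_eq_stMk (.r1 i j h a b)).symm
  long_add hi ξ ζ := by
    obtain ⟨i, rfl⟩ := exists_omega_coe hi
    simp only [← stMk_Y, ← map_mul]
    exact (stMk_eq_stMk (.r2 i ξ ζ)).symm
  commute_short hij hhk hc a b := by
    obtain ⟨i, j, rfl, rfl, h⟩ := hij.exists_coe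
    obtain ⟨k, l, rfl, rfl, h'⟩ := hhk.exists_coe
    simp only [← Omega.coe_neg, ne_eq, Subtype.coe_inj] at hc
    rw [← commutatorElement_eq_one_iff_commute, ← stMk_X h, ← stMk_X h', ← map_commutatorElement,
      stMk_eq_stMk (.r3 i j k l h h' a b hc.1 hc.2.1 hc.2.2.1 hc.2.2.2), map_one]
  commute_long_short hi hjk hc ξ a := by
    obtain ⟨i, rfl⟩ := exists_omega_coe hi
    obtain ⟨j, k, rfl, rfl, h⟩ := hjk.exists_coe
    simp only [← Omega.coe_neg, ne_eq, Subtype.coe_inj] at hc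
    rw [← commutatorElement_eq_one_iff_commute, ← stMk_X h, ← stMk_Y, ← map_commutatorElement,
      stMk_eq_stMk (.r4 i j k h ξ a hc.1 hc.2), map_one]
  short_short {i j k} hij hjk hik a b := by
    lift i to Omega n using ⟨hij.1, abs_le.2 ⟨hij.2.1, hij.2.2.1⟩⟩
    lift j to Omega n using ⟨hjk.1, abs_le.2 ⟨hjk.2.1, hjk.2.2.1⟩⟩
    obtain ⟨-, k, -, rfl, -⟩ := hjk.exists_coe
    have h₁ : Omega.Apart i j := apart_mk hij
    have h₂ : Omega.Apart j k := apart_mk hjk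
    have h₃ : Omega.Apart i k := apart_mk hik
    rw [← stMk_X h₁, ← stMk_X h₂, ← stMk_X h₃, ← map_commutatorElement]
    exact stMk_eq_stMk (.r5 i j k h₁ h₂ h₃ a b)
  long_long hij ξ ζ := by
    obtain ⟨i, j, rfl, rfl, h⟩ := hij.exists_coe
    rw [← Omega.coe_neg, ← stMk_X h.neg_right, ← stMk_Y, ← stMk_Y, ← map_commutatorElement]
    exact stMk_eq_stMk (.r6 i j h ξ ζ)
  long_self hi ξ ζ := by
    obtain ⟨i, rfl⟩ := exists_omega_coe hi
    rw [← stMk_Y, ← stMk_Y, ← stMk_Y, ← map_commutatorElement]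
    exact stMk_eq_stMk (.r7 i ξ ζ)
  long_short hij ξ b := by
    obtain ⟨i, j, rfl, rfl, h⟩ := hij.exists_coe
    rw [← Omega.coe_neg, ← Omega.coe_neg, ← stMk_X h, ← stMk_X h.neg_left, ← stMk_Y, ← stMk_Y,
      ← map_commutatorElement, ← map_mul]
    exact stMk_eq_stMk (.r8 i j h ξ b)
  short_short_neg hij a b := by
    obtain ⟨i, j, rfl, rfl, h⟩ := hij.exists_coe
    rw [← Omega.coe_neg, ← stMk_X h, ← stMk_X h.symm.neg_right, ← hyp_eq_hypElt, ← stMk_Y,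
      ← map_commutatorElement]
    exact stMk_eq_stMk (.r9 i j h a b)

/-- A group with the Steinberg relations receives a homomorphism from the Steinberg group. -/
theorem SteinbergRel.exists_hom {G : Type*} [Group G] {x : ℤ → ℤ → R → G} {y : ℤ → L.Elt → G}
    (S : L.SteinbergRel n x y) : ∃ f : L.StU n →* G,
      (∀ i j, ApartIn n i j → ∀ a, f (stX L n i j a) = x i j a) ∧
      ∀ i : ℤ, i ≠ 0 ∧ -n ≤ i ∧ i ≤ n → ∀ ξ, f (stY L n i ξ) = y i ξ := by
  let φ : L.Gen n → G := fun g => match g with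
    | .short i j _ a => x i j a
    | .long i ξ => y i ξ
  have hX : ∀ i j h a, FreeGroup.lift φ (L.X i j h a) = x i j a :=
    fun i j h a => FreeGroup.lift_apply_of
  have hY : ∀ i ξ, FreeGroup.lift φ (L.Y i ξ) = y i ξ := fun i ξ => FreeGroup.lift_apply_of
  have hV : ∀ i : Omega n, (i : ℤ) ≠ 0 ∧ -(n : ℤ) ≤ i ∧ (i : ℤ) ≤ n :=
    fun i => ⟨i.2.1, abs_le.1 i.2.2⟩
  obtain ⟨f, hf⟩ := exists_comp_stMk_eq (FreeGroup.lift φ) fun a b hab => by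
    cases hab with
    | r0 i j h a => simp only [hX]; exact S.symm (.coe h) a
    | r1 i j h a b => simp only [hX, map_mul]; exact (S.short_add (.coe h) a b).symm
    | r2 i ξ ζ => simp only [hY, map_mul]; exact (S.long_add (hV i) ξ ζ).symm
    | r3 i j k l h h' a b h₁ h₂ h₃ h₄ =>
      simp only [hX, map_commutatorElement, map_one, commutatorElement_eq_one_iff_commute]
      refine S.commute_short (.coe h) (.coe h') ?_ a b
      simp only [← Omega.coe_neg, ne_eq, Subtype.coe_inj]
      exact ⟨h₁, h₂, h₃, h₄⟩
    | r4 i j k h ξ a h₁ h₂ =>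
      simp only [hX, hY, map_commutatorElement, map_one, commutatorElement_eq_one_iff_commute]
      refine S.commute_long_short (hV i) (.coe h) ?_ ξ a
      simp only [← Omega.coe_neg, ne_eq, Subtype.coe_inj]
      exact ⟨h₁, h₂⟩
    | r5 i j k h h' h'' a b =>
      simp only [hX, map_commutatorElement]
      exact S.short_short (.coe h) (.coe h') (.coe h'') a b
    | r6 i j h ξ ζ => simp only [hX, hY, map_commutatorElement]; exact S.long_long (.coe h) ξ ζ
    | r7 i ξ ζ => simp only [hY, map_commutatorElement]; exact S.long_self (hV i) ξ ζ
    | r8 i j h ξ b =>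
      simp only [hX, hY, map_commutatorElement, map_mul]
      exact S.long_short (.coe h) ξ b
    | r9 i j h a b =>
      simp only [hX, hY, map_commutatorElement, hyp_eq_hypElt]
      exact S.short_short_neg (.coe h) a b
  refine ⟨f, fun i j h a => ?_, fun i h ξ => ?_⟩
  · obtain ⟨i, j, rfl, rfl, hij⟩ := h.exists_coe
    rw [← stMk_X hij, ← hX i j hij, ← hf]; rfl
  · obtain ⟨i, rfl⟩ := exists_omega_coe h
    rw [← stMk_Y, ← hY, ← hf]; rfl

theorem stU_subgroup_eq_top {S : Subgroup (L.StU n)}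
    (hX : ∀ i j, ApartIn n i j → ∀ a, stX L n i j a ∈ S)
    (hY : ∀ i : ℤ, i ≠ 0 ∧ -n ≤ i ∧ i ≤ n → ∀ ξ, stY L n i ξ ∈ S) : S = ⊤ := by
  rw [eq_top_iff]
  rintro g -
  obtain ⟨g, rfl⟩ := stMk_surjective g
  have h : (⊤ : Subgroup (FreeGroup (L.Gen n))) ≤ S.comap (stMk L n) := by
    rw [← FreeGroup.closure_range_of, Subgroup.closure_le]
    rintro _ ⟨⟨i, j, h, a⟩ | ⟨i, ξ⟩, rfl⟩
    · have := hX i j (.coe h) a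
      rwa [← stMk_X h] at this
    · have := hY i ⟨i.2.1, abs_le.1 i.2.2⟩ ξ
      rwa [← stMk_Y] at this
  exact h (Subgroup.mem_top g)

theorem stU_hom_ext {G : Type*} [Group G] {f g : L.StU n →* G}
    (hX : ∀ i j, ApartIn n i j → ∀ a, f (stX L n i j a) = g (stX L n i j a))
    (hY : ∀ i : ℤ, i ≠ 0 ∧ -n ≤ i ∧ i ≤ n → ∀ ξ, f (stY L n i ξ) = g (stY L n i ξ)) :
    f = g :=
  MonoidHom.eq_of_eqOn_top fun a _ =>
    (stU_subgroup_eq_top (S := f.eqLocus g) hX hY).ge (Subgroup.mem_top a)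

theorem SteinbergRel.map {G G' : Type*} [Group G] [Group G'] {x : ℤ → ℤ → R → G}
    {y : ℤ → L.Elt → G} (S : L.SteinbergRel n x y) (f : G →* G') :
    L.SteinbergRel n (fun i j a => f (x i j a)) (fun i ξ => f (y i ξ)) where
  symm h a := congrArg f (S.symm h a)
  short_add h a b := by rw [S.short_add h, map_mul]
  long_add h ξ ζ := by rw [S.long_add h, map_mul]
  commute_short h h' hc a b := (S.commute_short h h' hc a b).map f
  commute_long_short h h' hc ξ a := (S.commute_long_short h h' hc ξ a).map f
  short_short h h' h'' a b := by rw [← map_commutatorElement, S.short_short h h' h'']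
  long_long h ξ ζ := by rw [← map_commutatorElement, S.long_long h]
  long_self h ξ ζ := by rw [← map_commutatorElement, S.long_self h]
  long_short h ξ b := by rw [← map_commutatorElement, S.long_short h, map_mul]
  short_short_neg h a b := by rw [← map_commutatorElement, S.short_short_neg h]

/-- Homomorphisms from the Steinberg group lift along central extensions. -/
theorem exists_stU_lift (hn : 5 ≤ n) {H G : Type*} [Group H] [Group G] {ε : H →* G}
    (hε : IsCentralExtension ε) (φ : L.StU n →* G) : ∃ η : L.StU n →* H, ε.comp η = φ := by
  -- The relations are used in the target of `φ`, which the images need not generate; the direct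
  -- limit requires this generality.
  have S := (steinbergRel_stU L n).map φ
  obtain ⟨η, hX, hY⟩ := (S.lift hε hn).exists_hom
  refine ⟨η, stU_hom_ext (fun i j h a => ?_) fun i h ξ => ?_⟩
  · rw [MonoidHom.comp_apply, hX i j h, S.map_liftShort hε hn h]
  · rw [MonoidHom.comp_apply, hY i h, S.map_liftLong hε hn h]

theorem isPerfect_stU (hn : 5 ≤ n) : Group.IsPerfect (L.StU n) := by
  have S := steinbergRel_stU L n
  have key : ∀ a b : L.StU n, ⁅a, b⁆ ∈ commutator (L.StU n) := fun a b =>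
    Subgroup.commutator_mem_commutator (Subgroup.mem_top a) (Subgroup.mem_top b)
  have hX : ∀ i j, ApartIn n i j → ∀ a, stX L n i j a ∈ commutator (L.StU n) := by
    intro i j h a
    obtain ⟨k, hk⟩ := exists_apart i j i j
    rw [← mul_one a, ← S.short_short (i := i) (j := k) (by omega) (by omega) h]
    exact key _ _
  have hY : ∀ i : ℤ, i ≠ 0 ∧ -n ≤ i ∧ i ≤ n → ∀ ξ, stY L n i ξ ∈ commutator (L.StU n) := by
    intro i h ξ
    obtain ⟨k, hk⟩ := exists_apart i i i i
    have hki : ApartIn n k (-i) := by omega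
    have e := S.long_short hki ξ.conj 1
    rw [neg_neg, Elt.act_one, Elt.conj_conj] at e
    -- A long generator is a commutator up to a short generator, already known to lie in the
    -- commutator subgroup.
    rw [eq_inv_mul_of_mul_eq e.symm]
    exact mul_mem (inv_mem (hX _ _ hki _)) (key _ _)
  exact Group.isPerfect_def.2 (stU_subgroup_eq_top hX hY)

theorem isCentrallyClosed_stU (hn : 5 ≤ n) : IsCentrallyClosed.{max u v, w} (L.StU n) :=
  isCentrallyClosed_of_exists_section (isPerfect_stU hn) fun _ _ _ hε =>
    exists_stU_lift hn hε (MonoidHom.id _)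

/-! ### The stable Steinberg group -/

variable (L) in
/-- The canonical homomorphism to the direct limit. -/
def toStUInf (k : Set.Ici (3 : ℕ)) : L.StU k →* L.StUInf where
  toFun x := ⟦⟨k, x⟩⟧
  map_one' := (DirectLimit.one_def (G := fun k : Set.Ici (3 : ℕ) => L.StU k)
    (f := fun k l (h : k ≤ l) => L.stuMap (Subtype.coe_le_coe.mpr h)) k).symm
  map_mul' x y := (DirectLimit.mul_def (G := fun k : Set.Ici (3 : ℕ) => L.StU k)
    (f := fun k l (h : k ≤ l) => L.stuMap (Subtype.coe_le_coe.mpr h)) k x y).symm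

theorem toStUInf_stuMap {k l : Set.Ici (3 : ℕ)} (h : k ≤ l) (x : L.StU k) :
    toStUInf L l (L.stuMap (Subtype.coe_le_coe.mpr h) x) = toStUInf L k x :=
  DirectLimit.mk_apply (F := fun k : Set.Ici (3 : ℕ) => L.StU k)
    (f := fun k l (h : k ≤ l) => L.stuMap (Subtype.coe_le_coe.mpr h)) k l x h

/-- An index of the direct system which is at least `k` and `5`. -/
def maxFive (k : Set.Ici (3 : ℕ)) : Set.Ici (3 : ℕ) :=
  ⟨max (k : ℕ) 5, le_trans k.2 (le_max_left (k : ℕ) 5)⟩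

theorem le_maxFive (k : Set.Ici (3 : ℕ)) : k ≤ maxFive k := le_max_left (k : ℕ) 5

theorem five_le_maxFive (k : Set.Ici (3 : ℕ)) : 5 ≤ (maxFive k : ℕ) := le_max_right (k : ℕ) 5

theorem maxFive_mono {k l : Set.Ici (3 : ℕ)} (h : k ≤ l) : maxFive k ≤ maxFive l :=
  max_le_max_right 5 (show (k : ℕ) ≤ l from h)

theorem exists_toStUInf_eq (x : L.StUInf) :
    ∃ (k : Set.Ici (3 : ℕ)) (y : L.StU k), 5 ≤ (k : ℕ) ∧ toStUInf L k y = x := by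
  obtain ⟨k, y, rfl⟩ := DirectLimit.exists_eq_mk _ x
  exact ⟨maxFive k, _, five_le_maxFive k, toStUInf_stuMap (le_maxFive k) y⟩

theorem isPerfect_stUInf : Group.IsPerfect L.StUInf := by
  rw [Group.isPerfect_def, eq_top_iff]
  rintro x -
  obtain ⟨k, y, hk, rfl⟩ := exists_toStUInf_eq x
  have := isPerfect_stU (L := L) hk
  have hle : (commutator (L.StU k)).map (toStUInf L k) ≤ commutator L.StUInf := by
    rw [commutator_def, commutator_def, Subgroup.map_commutator]
    exact Subgroup.commutator_mono le_top le_top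
  exact hle (Subgroup.mem_map_of_mem _ Group.IsPerfect.mem_commutator)

theorem stuMap_stuMap {k l m : ℕ} (h : k ≤ l) (h' : l ≤ m) (x : L.StU k) :
    L.stuMap h' (L.stuMap h x) = L.stuMap (h.trans h') x := by
  obtain ⟨x, rfl⟩ := stMk_surjective x
  change stMk L m _ = stMk L m _
  rw [FreeGroup.map.comp]
  congr 3
  funext g; cases g <;> rfl

/-- Levels below `5` are first sent to level `5`. Each canonical map to the limit then lifts to `H`,
and the lifts glue because perfectness makes them unique. -/
theorem exists_stUInf_section {H : Type*} [Group H] {ε : H →* L.StUInf}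
    (hε : IsCentralExtension ε) : ∃ η : L.StUInf →* H, ε.comp η = MonoidHom.id _ := by
  choose η hη using fun k : Set.Ici (3 : ℕ) =>
    exists_stU_lift (five_le_maxFive k) hε (toStUInf L (maxFive k))
  have compat : ∀ (k l : Set.Ici (3 : ℕ)) (h : k ≤ l),
      (η l).comp (L.stuMap (maxFive_mono h)) = η k := by
    intro k l h
    have := isPerfect_stU (L := L) (five_le_maxFive k)
    refine hε.hom_eq_of_comp_eq ?_
    rw [← MonoidHom.comp_assoc, hη, hη]
    exact MonoidHom.ext (toStUInf_stuMap (maxFive_mono h))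
  let ψ : L.StUInf → H := DirectLimit.lift (F := fun k : Set.Ici (3 : ℕ) => L.StU k)
    (f := fun k l (h : k ≤ l) => L.stuMap (Subtype.coe_le_coe.mpr h))
    (fun k x => η k (L.stuMap (le_maxFive k) x)) (fun k l h x => by
      rw [← compat k l h, MonoidHom.comp_apply, stuMap_stuMap, stuMap_stuMap])
  have hψ : ∀ k x, ψ (toStUInf L k x) = η k (L.stuMap (le_maxFive k) x) := fun k x => rfl
  refine ⟨MonoidHom.mk' ψ fun a b => ?_, MonoidHom.ext fun a => ?_⟩
  · obtain ⟨k, x, y, rfl, rfl⟩ := DirectLimit.exists_eq_mk₂ _ a b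
    change ψ (toStUInf L k x * toStUInf L k y) = ψ (toStUInf L k x) * ψ (toStUInf L k y)
    rw [← map_mul, hψ, hψ, hψ, map_mul, map_mul]
  · obtain ⟨k, x, rfl⟩ := DirectLimit.exists_eq_mk _ a
    change ε (ψ (toStUInf L k x)) = toStUInf L k x
    rw [hψ, ← MonoidHom.comp_apply, hη]
    exact toStUInf_stuMap (le_maxFive k) x

theorem isCentrallyClosed_stUInf : IsCentrallyClosed.{max u v, w} L.StUInf :=
  isCentrallyClosed_of_exists_section isPerfect_stUInf fun _ _ _ hε => exists_stUInf_section hε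

end OddFormParameter

theorem theorem1 {R : Type u} [Ring R] {P : PseudoInvolution R}
    {V : Type v} [AddCommGroup V] [Module Rᵐᵒᵖ V] {B : AntiHermitianForm P V}
    (L : OddFormParameter B) :
    (∀ n : ℕ, 5 ≤ n →
      IsCentrallyClosed.{max u v, w} (L.StU n) ∧
      ∀ (U : Type w) [Group U] (π : U →* L.StU n),
        IsUniversalCentralExtension.{w, max u v, w} π → π.ker = ⊥) ∧
    (IsCentrallyClosed.{max u v, w} L.StUInf ∧
      ∀ (U : Type w) [Group U] (π : U →* L.StUInf),
        IsUniversalCentralExtension.{w, max u v, w} π → π.ker = ⊥) :=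
  ⟨fun _ hn => ⟨OddFormParameter.isCentrallyClosed_stU hn, fun _ _ _ hπ =>
      (OddFormParameter.isCentrallyClosed_stU hn).ker_eq_bot hπ⟩,
    OddFormParameter.isCentrallyClosed_stUInf, fun _ _ _ hπ =>
      OddFormParameter.isCentrallyClosed_stUInf.ker_eq_bot hπ⟩
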